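/- Let $\Omega\subset\mathbb R^3$ be open, bounded and simply connected, with boundary $\Gamma$ of finite surface area and outward unit normal $n$. Write $X=L^2(\Omega;\mathbb R^3)$ and $\mathcal H=\{v\in H^1_0(\Omega):\nabla v\in H(\operatorname{div};\Omega),\ \partial_n v\in L^2(\Gamma)\}$ with norm $\|v\|_{\mathcal H}=(\|v\|_{H^1}^2+\|\Delta v\|_{L^2(\Omega)}^2+\|\partial_n v\|_{L^2(\Gamma)}^2)^{1/2}$. Assume that for every $g\in L^2(\Omega)$ there is a unique $w\in\mathcal H$ with $\int_\Omega\nabla w\cdot\nabla v\,dx=\int_\Omega g v\,dx$ for all $v\in H_0^1(\Omega)$, and that $\|w\|_{\mathcal H}\le C\|g\|_{L^2(\Omega)}$ with $C$ independent of $g$ and $w$. Then for every $u\in L^2(\Gamma)$ there is a unique $\eta_u\in L^2(\Omega)$ (the very weak solution of $-\Delta\eta=0$ in $\Omega$, $\eta=u$ on $\Gamma$) with $-\int_\Omega \eta_u\Delta v\,dx+\int_\Gamma u\,\partial_n v\,d\varsigma=0$ for all $v\in\mathcal H$. Let $T,c,m_0,q,\alpha>0$, $R\in\mathbb R$, $p_0\in\mathbb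 R^3$, $E_0,B_0\in X$. Let $\varphi\in C^{2,1}(\mathbb R^3)$ be nonnegative and rotationally symmetric with $\int\varphi=1$ and support in the ball of radius $R$ about $0$. Let $J_1,J_2\in C^1(\mathbb R^3)$ be bounded from below, and let $g_1,\dots,g_m\in C^1(\mathbb R^3)$ be such that $\tilde\Omega=\{x\in\mathbb R^3: g_i(x)\le 0,\ i=1,\dots,m\}$ satisfies $\tilde\Omega\subset\Omega$ and $\operatorname{dist}(\tilde\Omega,\Gamma)>R$. Let $r_0\in\tilde\Omega$. For $p\in\mathbb R^3$ put $v(p)=\dfrac{p}{m_0\sqrt{1+|p|^2/(m_0c)^2}}$ and $\beta(p)=c^{-1}v(p)$. Let $\mathcal A(V_1,V_2)=(-\operatorname{curl}V_2,\operatorname{curl}V_1)$ on $X\times X$ with domain $\{V\in H(\operatorname{curl};\Omega)^2: V_1\times n=0 \text{ on }\Gamma\}$, and let $\mathcal G$ be the $C_0$-semigroup generated by $-\mathcal A$. For continuous $r,p:[0,T]\to\mathbb R^3$ let $j(r,p)(t)=(-q\,\varphi(\cdot-r(t))\,v(p(t)),0)\in X\times X$, let $$(E,B)(t)=\mathcal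 G(t)(E_0,B_0)+\int_0^t\mathcal G(t-\tau)\,j(r,p)(\tau)\,d\tau$$ be the corresponding mild solution of Maxwell's equations, and let $F_L(r,p)(t)=E(t)+\beta(p(t))\times B(t)$. Consider the problem (P): minimize $$\mathcal J(w+r_0,u)=\int_0^T J_1(w(t)+r_0)\,dt+J_2(w(T)+r_0)+\frac{\alpha}{2}\int_\Gamma u^2\,d\varsigma$$ over all $u\in L^2(\Gamma)$ and $w,z\in C^1([0,T];\mathbb R^3)$ with $w(0)=z(0)=0$ such that, for all $t\in[0,T]$, the state equations $$\dot w(t)=v(z(t)+p_0),$$ $$\begin{aligned}\dot z(t)={}&q\int_\Omega\varphi(x-w(t)-r_0)\,F_L(w+r_0,z+p_0)(t)\,dx\\&-q\int_\Omega\eta_u\,\nabla\varphi(x-w(t)-r_0)\times\beta(z(t)+p_0)\,dx+q\int_\Gamma u\,\varphi(x-w(t)-r_0)\,\beta(z(t)+p_0)\times n\,d\varsigma\end{aligned}$$ and the state constraints $g_i(w(t)+r_0)\le0$, $i=1,\dots,m$, hold. If there is a control $u\in L^2(\Gamma)$ with an associated state $(w,z)$ (a solution of the state equations) satisfying the state constraints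 for all $t\in[0,T]$, then (P) has at least one globally optimal control: there is a feasible triple $(w^*,z^*,u^*)$ with $\mathcal J(w^*+r_0,u^*)\le\mathcal J(w+r_0,u)$ for all feasible $(w,z,u)$. -/

import Mathlib

open MeasureTheory Filter Topology Set
open scoped ContDiff

noncomputable section

namespace AbrahamControl

/-- Three-dimensional Euclidean space. -/
abbrev E3 : Type := EuclideanSpace ℝ (Fin 3)

/-- The vector product on `E3`. -/
def cross (a b : E3) : E3 := WithLp.toLp 2 (crossProduct a.ofLp b.ofLp)

/-- `partialAt i F x j` is the partial derivative `∂_i F_j` at `x`. -/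
def partialAt (i : Fin 3) (F : E3 → E3) (x : E3) (j : Fin 3) : ℝ :=
  fderiv ℝ F x (EuclideanSpace.single i 1) j

/-- The classical curl of a differentiable vector field. -/
def curl (F : E3 → E3) (x : E3) : E3 :=
  !₂[partialAt 1 F x 2 - partialAt 2 F x 1,
     partialAt 2 F x 0 - partialAt 0 F x 2,
     partialAt 0 F x 1 - partialAt 1 F x 0]

/-! ### Function spaces on `Ω` and on its boundary -/

/-- `L²(Ω)`. -/
abbrev L2 (Ω : Set E3) : Type := Lp ℝ 2 (volume.restrict Ω)

/-- `X = L²(Ω; ℝ³)`. -/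
abbrev X (Ω : Set E3) : Type := Lp E3 2 (volume.restrict Ω)

/-- Surface measure on `Γ = ∂Ω`: the two-dimensional Hausdorff measure, normalized so that it
agrees with Lebesgue measure on planes, restricted to the boundary. -/
def surface (Ω : Set E3) : Measure E3 :=
  (Measure.euclideanHausdorffMeasure 2 : Measure E3).restrict (frontier Ω)

/-- `L²(Γ)`. -/
abbrev L2Bdry (Ω : Set E3) : Type := Lp ℝ 2 (surface Ω)

/-- The class in `X` of a square integrable vector field (and `0` for other fields). -/
def toX (Ω : Set E3) (f : E3 → E3) : X Ω :=
  open Classical in if h : MemLp f 2 (volume.restrict Ω) then h.toLp f else 0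

/-- `ν` is an outward unit normal of `Ω` at `x`: near `x`, every open cone around `-ν` of opening
less than a right angle lies in `Ω`, and every such cone around `ν` lies outside `Ω`. -/
def IsOutwardNormal (Ω : Set E3) (x ν : E3) : Prop :=
  ‖ν‖ = 1 ∧ ∀ δ > 0, ∃ ρ > 0, ∀ y ∈ Metric.ball x ρ,
    (inner ℝ (y - x) ν < -(δ * ‖y - x‖) → y ∈ Ω) ∧
    (δ * ‖y - x‖ < inner ℝ (y - x) ν → y ∉ Ω)

/-- The outward unit normal field `n` on `Γ` (with value `0` at points without a normal). -/
def normal (Ω : Set E3) (x : E3) : E3 :=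
  open Classical in if h : ∃ ν, IsOutwardNormal Ω x ν then h.choose else 0

/-- `ψ ∈ C_c^∞(U; F)`. -/
def IsTest {F : Type} [NormedAddCommGroup F] [NormedSpace ℝ F] (U : Set E3) (ψ : E3 → F) : Prop :=
  ContDiff ℝ ∞ ψ ∧ HasCompactSupport ψ ∧ tsupport ψ ⊆ U

/-- `f ∈ H(curl; Ω)` with distributional curl `c`. -/
def HasCurl (Ω : Set E3) (f c : X Ω) : Prop :=
  ∀ ψ : E3 → E3, IsTest Ω ψ →
    ∫ x in Ω, inner ℝ (f x) (curl ψ x) = ∫ x in Ω, inner ℝ (c x) (ψ x)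

/-- `f ∈ H(curl; Ω)` with curl `c` and vanishing tangential trace `f × n = 0` on `Γ`, that is,
`(f, c)` belongs to the closure of the graph of `curl` on `C_c^∞(Ω; ℝ³)`. -/
def HasCurlZeroTrace (Ω : Set E3) (f c : X Ω) : Prop :=
  (f, c) ∈ closure {a : X Ω × X Ω | ∃ ψ : E3 → E3, IsTest Ω ψ ∧
    a.1 =ᵐ[volume.restrict Ω] ψ ∧ a.2 =ᵐ[volume.restrict Ω] curl ψ}

/-- `v ∈ H¹₀(Ω)` with weak gradient `Dv`: closure of `C_c^∞(Ω)` with respect to the `H¹` norm. -/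
def MemH10 (Ω : Set E3) (v : L2 Ω) (Dv : X Ω) : Prop :=
  (v, Dv) ∈ closure {a : L2 Ω × X Ω | ∃ ψ : E3 → ℝ, IsTest Ω ψ ∧
    a.1 =ᵐ[volume.restrict Ω] ψ ∧ a.2 =ᵐ[volume.restrict Ω] gradient ψ}

/-- `f ∈ H(div; Ω)` with distributional divergence `d`. -/
def HasDiv (Ω : Set E3) (f : X Ω) (d : L2 Ω) : Prop :=
  ∀ ψ : E3 → ℝ, IsTest Ω ψ →
    ∫ x in Ω, inner ℝ (f x) (gradient ψ x) = -∫ x in Ω, d x * ψ x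

/-- The normal trace `f · n` of a field `f ∈ H(div; Ω)` with divergence `d` is the function
`h ∈ L²(Γ)`; the normal trace is defined by Green's formula. -/
def HasNormalTrace (Ω : Set E3) (f : X Ω) (d : L2 Ω) (h : L2Bdry Ω) : Prop :=
  ∀ ψ : E3 → ℝ, IsTest univ ψ →
    ∫ x, h x * ψ x ∂(surface Ω) =
      (∫ x in Ω, inner ℝ (f x) (gradient ψ x)) + ∫ x in Ω, d x * ψ x

/-- `v` belongs to `𝓗 = {v ∈ H¹₀(Ω) : ∇v ∈ H(div; Ω), ∂ₙv ∈ L²(Γ)}`, with gradient `Dv`,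
Laplacian `Lv = div ∇v` and normal derivative `dn = ∂ₙv`. -/
def MemH (Ω : Set E3) (v : L2 Ω) (Dv : X Ω) (Lv : L2 Ω) (dn : L2Bdry Ω) : Prop :=
  MemH10 Ω v Dv ∧ HasDiv Ω Dv Lv ∧ HasNormalTrace Ω Dv Lv dn

/-- `∫_Ω ∇w · ∇v = ∫_Ω g v` for all `v ∈ H¹₀(Ω)`, where `Dw = ∇w`. -/
def SolvesWeakPoisson (Ω : Set E3) (g : L2 Ω) (Dw : X Ω) : Prop :=
  ∀ (v : L2 Ω) (Dv : X Ω), MemH10 Ω v Dv →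
    ∫ x in Ω, inner ℝ (Dw x) (Dv x) = ∫ x in Ω, g x * v x

/-- For every `g ∈ L²(Ω)` the weak Poisson equation has a unique solution `w ∈ 𝓗`, and
`‖w‖_𝓗 ≤ C ‖g‖` with `C` independent of `g` and `w`. -/
def PoissonRegular (Ω : Set E3) : Prop :=
  (∀ g : L2 Ω, ∃! w : L2 Ω, ∃ (Dw : X Ω) (Lw : L2 Ω) (dn : L2Bdry Ω),
    MemH Ω w Dw Lw dn ∧ SolvesWeakPoisson Ω g Dw) ∧
  ∃ C > 0, ∀ (g w : L2 Ω) (Dw : X Ω) (Lw : L2 Ω) (dn : L2Bdry Ω),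
    MemH Ω w Dw Lw dn → SolvesWeakPoisson Ω g Dw →
      Real.sqrt ((‖w‖ ^ 2 + ‖Dw‖ ^ 2) + ‖Lw‖ ^ 2 + ‖dn‖ ^ 2) ≤ C * ‖g‖

/-! ### Very weak solutions of Laplace's equation with Dirichlet data in `L²(Γ)` -/

/-- `η ∈ L²(Ω)` is a very weak solution of `-Δη = 0` in `Ω`, `η = u` on `Γ`. -/
def IsVeryWeakSolution (Ω : Set E3) (u : L2Bdry Ω) (η : L2 Ω) : Prop :=
  ∀ (v : L2 Ω) (Dv : X Ω) (Lv : L2 Ω) (dn : L2Bdry Ω), MemH Ω v Dv Lv dn →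
    -(∫ x in Ω, η x * Lv x) + ∫ x, u x * dn x ∂(surface Ω) = 0

/-- The very weak solution with Dirichlet data `u`; it exists and is unique when `PoissonRegular`
holds. -/
def potential (Ω : Set E3) (u : L2Bdry Ω) : L2 Ω :=
  open Classical in if h : ∃ η, IsVeryWeakSolution Ω u η then h.choose else 0

/-! ### The Maxwell semigroup -/

/-- `V` lies in the domain of the Maxwell operator `𝓐 (V₁, V₂) = (-curl V₂, curl V₁)`,
`D(𝓐) = {V ∈ H(curl; Ω)² : V₁ × n = 0}`, and `𝓐 V = W`. -/
def MaxwellOp (Ω : Set E3) (V W : X Ω × X Ω) : Prop :=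
  HasCurlZeroTrace Ω V.1 W.2 ∧ HasCurl Ω V.2 (-W.1)

/-- `G`, restricted to `[0, ∞)`, is a strongly continuous semigroup of bounded operators. -/
structure IsC0Semigroup {H : Type} [NormedAddCommGroup H] [NormedSpace ℝ H]
    (G : ℝ → H →L[ℝ] H) : Prop where
  zero : G 0 = ContinuousLinearMap.id ℝ H
  add : ∀ s t, 0 ≤ s → 0 ≤ t → G (s + t) = (G s).comp (G t)
  cont : ∀ V, ContinuousOn (fun t => G t V) (Ici 0)

/-- The infinitesimal generator of `G` is the operator with graph `A`. -/
def HasGenerator {H : Type} [NormedAddCommGroup H] [NormedSpace ℝ H]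
    (G : ℝ → H →L[ℝ] H) (A : H → H → Prop) : Prop :=
  ∀ V W, A V W ↔ Tendsto (fun h : ℝ => h⁻¹ • (G h V - V)) (𝓝[>] 0) (𝓝 W)

/-- `G` is the semigroup solving `∂ₜ V + 𝓐 V = 0`, that is, the one generated by `-𝓐`. -/
def IsMaxwellSemigroup (Ω : Set E3) (G : ℝ → (X Ω × X Ω) →L[ℝ] (X Ω × X Ω)) : Prop :=
  IsC0Semigroup G ∧ HasGenerator G (fun V W => MaxwellOp Ω V (-W))

/-- The Maxwell semigroup `𝓖`. As `𝓐` is skew-adjoint for every open `Ω`, the semigroup exists; its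
operators for nonnegative times are determined by the generator. -/
def maxwellSemigroup (Ω : Set E3) : ℝ → (X Ω × X Ω) →L[ℝ] (X Ω × X Ω) :=
  open Classical in if h : ∃ G, IsMaxwellSemigroup Ω G then h.choose else 0

/-! ### The optimal control problem -/

/-- The data of the optimal control problem. -/
structure ProblemData where
  /-- the interior of the accelerator -/
  Ω : Set E3
  /-- final time -/
  T : ℝ
  /-- speed of light -/
  c : ℝ
  /-- rest mass of the particle -/
  m₀ : ℝ
  /-- charge of the particle -/
  q : ℝ
  /-- radius of the smeared out point charge -/
  R : ℝ
  /-- Tikhonov parameter -/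
  α : ℝ
  /-- smeared out delta distribution -/
  φ : E3 → ℝ
  /-- initial position -/
  r₀ : E3
  /-- initial momentum -/
  p₀ : E3
  /-- initial electric field -/
  E₀ : X Ω
  /-- initial magnetic field -/
  B₀ : X Ω
  /-- running cost -/
  J₁ : E3 → ℝ
  /-- terminal cost -/
  J₂ : E3 → ℝ
  /-- number of state constraints -/
  m : ℕ
  /-- state constraint functions -/
  g : Fin m → E3 → ℝ

namespace ProblemData

variable (P : ProblemData)

/-- `Ω̃ = {x : g_i(x) ≤ 0, i = 1, …, m}`. -/
def admissible : Set E3 := {x | ∀ i, P.g i x ≤ 0}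

/-- The standing assumptions on the data. -/
structure StandingAssumptions : Prop where
  isOpen : IsOpen P.Ω
  isBounded : Bornology.IsBounded P.Ω
  simplyConnected : IsSimplyConnected P.Ω
  surface_finite : surface P.Ω univ < ⊤
  poissonRegular : PoissonRegular P.Ω
  T_pos : 0 < P.T
  c_pos : 0 < P.c
  m₀_pos : 0 < P.m₀
  q_pos : 0 < P.q
  α_pos : 0 < P.α
  φ_contDiff : ContDiff ℝ 2 P.φ
  φ_lipschitz : ∃ K, LipschitzWith K (iteratedFDeriv ℝ 2 P.φ)
  φ_support : tsupport P.φ ⊆ Metric.closedBall 0 P.R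
  φ_nonneg : ∀ x, 0 ≤ P.φ x
  φ_integral : ∫ x, P.φ x = 1
  φ_radial : ∀ x y, ‖x‖ = ‖y‖ → P.φ x = P.φ y
  g_contDiff : ∀ i, ContDiff ℝ 1 (P.g i)
  admissible_subset : P.admissible ⊆ P.Ω
  /-- `dist(Ω̃, Γ) > R`; both sets are compact and nonempty, so the distance is attained. -/
  admissible_dist : ∀ x ∈ P.admissible, ∀ y ∈ frontier P.Ω, P.R < dist x y
  r₀_mem : P.r₀ ∈ P.admissible
  J₁_contDiff : ContDiff ℝ 1 P.J₁
  J₂_contDiff : ContDiff ℝ 1 P.J₂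
  J₁_bddBelow : ∃ c₁ : ℝ, ∀ x, c₁ ≤ P.J₁ x
  J₂_bddBelow : ∃ c₂ : ℝ, ∀ x, c₂ ≤ P.J₂ x

/-- The Lorentz factor. -/
def γ (p : E3) : ℝ := Real.sqrt (1 + ‖p‖ ^ 2 / (P.m₀ * P.c) ^ 2)

/-- The velocity of a particle with momentum `p`. -/
def v (p : E3) : E3 := (P.m₀ * P.γ p)⁻¹ • p

/-- `β(p) = v(p) / c`. -/
def β (p : E3) : E3 := P.c⁻¹ • P.v p

/-- The current density `j(r, p)(t) = (-q φ(· - r(t)) v(p(t)), 0) ∈ X × X`. -/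
def current (r p : ℝ → E3) (t : ℝ) : X P.Ω × X P.Ω :=
  (toX P.Ω (fun x => -(P.q * P.φ (x - r t)) • P.v (p t)), 0)

/-- The mild solution `(E(t), B(t))` of Maxwell's equations with current `j(r, p)`. -/
def field (r p : ℝ → E3) (t : ℝ) : X P.Ω × X P.Ω :=
  maxwellSemigroup P.Ω t (P.E₀, P.B₀) +
    ∫ τ in (0 : ℝ)..t, maxwellSemigroup P.Ω (t - τ) (P.current r p τ)

/-- The Lorentz force `F_L(r, p)(x, t) = E(x, t) + β(p(t)) × B(x, t)`. -/
def lorentz (r p : ℝ → E3) (t : ℝ) (x : E3) : E3 :=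
  (P.field r p t).1 x + cross (P.β (p t)) ((P.field r p t).2 x)

/-- First component of the state system operator (momentum equation). -/
def e₁ (w z : ℝ → E3) (u : L2Bdry P.Ω) (t : ℝ) : E3 :=
  derivWithin z (Icc 0 P.T) t
    - P.q • (∫ x in P.Ω, P.φ (x - w t - P.r₀) •
        P.lorentz (fun s => w s + P.r₀) (fun s => z s + P.p₀) t x)
    + P.q • (∫ x in P.Ω, potential P.Ω u x •
        cross (gradient P.φ (x - w t - P.r₀)) (P.β (z t + P.p₀)))
    - P.q • (∫ x, (u x * P.φ (x - w t - P.r₀)) •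
        cross (P.β (z t + P.p₀)) (normal P.Ω x) ∂(surface P.Ω))

/-- Second component of the state system operator (velocity equation). -/
def e₂ (w z : ℝ → E3) (t : ℝ) : E3 :=
  derivWithin w (Icc 0 P.T) t - P.v (z t + P.p₀)

/-- `w ∈ C¹([0, T]; ℝ³)` with `w(0) = 0`. -/
def MemC10 (w : ℝ → E3) : Prop := ContDiffOn ℝ 1 w (Icc 0 P.T) ∧ w 0 = 0

/-- `(w, z, u)` is a solution of the state system, so that `(w, z)` is the state associated with
the control `u`. -/
def IsState (w z : ℝ → E3) (u : L2Bdry P.Ω) : Prop :=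
  P.MemC10 w ∧ P.MemC10 z ∧ ∀ t ∈ Icc 0 P.T, P.e₁ w z u t = 0 ∧ P.e₂ w z t = 0

/-- The state constraint `g_i(w(t) + r₀) ≤ 0` for all `i` and all `t ∈ [0, T]`. -/
def StateConstraint (w : ℝ → E3) : Prop :=
  ∀ i, ∀ t ∈ Icc 0 P.T, P.g i (w t + P.r₀) ≤ 0

/-- The objective `∫₀ᵀ J₁(r(t)) dt + J₂(r(T)) + α/2 ∫_Γ u²`. -/
def objective (r : ℝ → E3) (u : L2Bdry P.Ω) : ℝ :=
  (∫ t in (0 : ℝ)..P.T, P.J₁ (r t)) + P.J₂ (r P.T)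
    + P.α / 2 * ∫ x, u x ^ 2 ∂(surface P.Ω)

/-- `(w, z, u)` is feasible for the optimal control problem. -/
def Feasible (w z : ℝ → E3) (u : L2Bdry P.Ω) : Prop :=
  P.IsState w z u ∧ P.StateConstraint w

/-- `u` is a globally optimal control: with a state of `u` it is feasible, and no feasible triple
has a smaller objective value. -/
def IsOptimalControl (u : L2Bdry P.Ω) : Prop :=
  ∃ w z : ℝ → E3, P.Feasible w z u ∧
    ∀ (w' z' : ℝ → E3) (u' : L2Bdry P.Ω), P.Feasible w' z' u' →
      P.objective (fun t => w t + P.r₀) u ≤ P.objective (fun t => w' t + P.r₀) u'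

end ProblemData

end AbrahamControl

end

/-!
The proof is the direct method. Along a minimizing sequence the Tikhonov term bounds the controls,
so a subsequence converges weakly in `L²(Γ)`. Speeds never exceed `c`, and the momenta have
uniformly bounded derivatives because the Maxwell field is bounded and the potential depends on
the control through a bounded operator, the adjoint of `Δv ↦ ∂ₙv` on `𝓗`; by Arzelà–Ascoli a
further subsequence of the states converges on `[0, T]`.

The equations pass to the limit in integral form. The field converges since the currents converge
in `X`. The potentials converge only weakly, but they enter the momentum equation paired with
translates of `∇φ`, which converge strongly in `L²`. The boundary term vanishes on feasible
states, as the charge never reaches `Γ`. Finally, the objective is weakly lower semicontinuous.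
-/

noncomputable section

namespace AbrahamControl

theorem exists_isMinOn_of_forall_seq {A : Type*} {S : Set A} {f : A → ℝ} (hS : S.Nonempty)
    (hf : BddBelow (f '' S))
    (hseq : ∀ x : ℕ → A, (∀ n, x n ∈ S) → ∀ I, Tendsto (fun n => f (x n)) atTop (𝓝 I) →
      ∃ a ∈ S, f a ≤ I) :
    ∃ a ∈ S, IsMinOn f S a := by
  obtain ⟨y, -, hy, hyS⟩ := exists_seq_tendsto_sInf (hS.image f) hf
  choose x hxS hxy using hyS
  obtain ⟨a, haS, ha⟩ := hseq x hxS _ (by simpa only [hxy] using hy)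
  exact ⟨a, haS, fun b hb => ha.trans (csInf_le hf (mem_image_of_mem f hb))⟩

section WeakConvergence

theorem exists_subseq_tendsto_toWeakSpace {H : Type*} [NormedAddCommGroup H]
    [InnerProductSpace ℝ H] [CompleteSpace H] [TopologicalSpace.SeparableSpace H] {u : ℕ → H}
    {C : ℝ} (hu : ∀ n, ‖u n‖ ≤ C) :
    ∃ (a : H) (k : ℕ → ℕ), StrictMono k ∧
      Tendsto (fun n => toWeakSpace ℝ H (u (k n))) atTop (𝓝 (toWeakSpace ℝ H a)) := by
  obtain ⟨l, -, k, hk, hl⟩ := WeakDual.isSeqCompact_closedBall ℝ H 0 C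
    (x := fun n => StrongDual.toWeakDual (InnerProductSpace.toDual ℝ H (u n)))
    (fun n => by simpa using hu n)
  refine ⟨(InnerProductSpace.toDual ℝ H).symm (WeakDual.toStrongDual l), k, hk, ?_⟩
  have hinj : Function.Injective (topDualPairing ℝ H).flip := fun a b hab =>
    ext_inner_left ℝ fun y => by
      simpa using LinearMap.congr_fun hab (InnerProductSpace.toDual ℝ H y)
  refine (WeakBilin.tendsto_iff_forall_eval_tendsto _ hinj).2 fun L => ?_
  obtain ⟨y, rfl⟩ := (InnerProductSpace.toDual ℝ H).surjective L
  have h := ((WeakDual.eval_continuous y).tendsto l).comp hl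
  have hpair : ∀ x, (topDualPairing ℝ H).flip (toWeakSpace ℝ H x)
      (InnerProductSpace.toDual ℝ H y) = inner ℝ x y := fun x => real_inner_comm x y
  have hl_apply : inner ℝ ((InnerProductSpace.toDual ℝ H).symm (WeakDual.toStrongDual l)) y = l y :=
    InnerProductSpace.toDual_symm_apply
  simp only [hpair, hl_apply]
  exact h

variable {ι E F G : Type*} {l : Filter ι} [NormedAddCommGroup E] [NormedSpace ℝ E]
  [NormedAddCommGroup F] [NormedSpace ℝ F] [NormedAddCommGroup G] [NormedSpace ℝ G]
  [FiniteDimensional ℝ F] {u : ι → E} {a : E}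

theorem tendsto_apply_of_tendsto_toWeakSpace
    (hu : Tendsto (fun i => toWeakSpace ℝ E (u i)) l (𝓝 (toWeakSpace ℝ E a))) (L : E →L[ℝ] F) :
    Tendsto (fun i => L (u i)) l (𝓝 (L a)) := by
  have := (toWeakSpace ℝ F).finiteDimensional
  have hcont : Continuous (toWeakSpace ℝ F).symm :=
    (toWeakSpace ℝ F).symm.toLinearMap.continuous_of_finiteDimensional
  exact ((hcont.comp (WeakSpace.map L).continuous).tendsto _).comp hu

theorem tendsto_apply_apply_of_tendsto_toWeakSpace
    (hu : Tendsto (fun i => toWeakSpace ℝ E (u i)) l (𝓝 (toWeakSpace ℝ E a))) {C : ℝ}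
    (hC : ∀ i, ‖u i‖ ≤ C) (L : E →L[ℝ] G →L[ℝ] F) {y : ι → G} {b : G}
    (hy : Tendsto y l (𝓝 b)) :
    Tendsto (fun i => L (u i) (y i)) l (𝓝 (L a b)) := by
  have hsmall : Tendsto (fun i => L (u i) (y i - b)) l (𝓝 0) := by
    have hbound : Tendsto (fun i => ‖L‖ * C * ‖y i - b‖) l (𝓝 0) := by
      simpa using (tendsto_iff_norm_sub_tendsto_zero.1 hy).const_mul (‖L‖ * C)
    refine squeeze_zero_norm (fun i => (L.le_opNorm₂ _ _).trans ?_) hbound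
    gcongr
    exact hC i
  simpa using hsmall.add (tendsto_apply_of_tendsto_toWeakSpace hu (L.flip b))

end WeakConvergence

theorem exists_clm_of_submodule {E F : Type*} [NormedAddCommGroup E] [NormedSpace ℝ E]
    [NormedAddCommGroup F] [NormedSpace ℝ F] (R : Submodule ℝ (E × F)) {C : ℝ}
    (hC : ∀ x y, (x, y) ∈ R → ‖y‖ ≤ C * ‖x‖) (htotal : ∀ x, ∃ y, (x, y) ∈ R) :
    ∃ S : E →L[ℝ] F, ∀ x y, (x, y) ∈ R ↔ S x = y := by
  have hbij : Function.Bijective (Prod.fst ∘ R.subtype) := by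
    refine ⟨(injective_iff_map_eq_zero ((LinearMap.fst ℝ E F).comp R.subtype)).2 ?_, fun x => ?_⟩
    · rintro ⟨⟨x, y⟩, hxy⟩ (rfl : x = 0)
      simpa using hC 0 y hxy
    · obtain ⟨y, hy⟩ := htotal x
      exact ⟨⟨(x, y), hy⟩, rfl⟩
  obtain ⟨S, rfl⟩ := Submodule.exists_eq_graph hbij
  exact ⟨S.mkContinuous C fun x => hC x (S x) rfl, fun x y => eq_comm⟩

theorem exists_subseq_tendsto_of_lipschitzOn {V : Type*} [MetricSpace V]
    [ProperSpace V] {a b : ℝ} (hab : a ≤ b) {f : ℕ → ℝ → V} {K : NNReal}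
    (hf : ∀ n, LipschitzOnWith K (f n) (Icc a b)) {x₀ : V} (h₀ : ∀ n, f n a = x₀) :
    ∃ (g : ℝ → V) (k : ℕ → ℕ), Continuous g ∧ StrictMono k ∧
      ∀ t ∈ Icc a b, Tendsto (fun n => f (k n) t) atTop (𝓝 (g t)) := by
  let F : ℕ → BoundedContinuousFunction (Icc a b) V := fun n =>
    BoundedContinuousFunction.mkOfCompact
      ⟨(Icc a b).domRestrict (f n), (hf n).continuousOn.domRestrict⟩
  have hF : ∀ n, LipschitzWith K (F n) := fun n => (hf n).to_restrict
  have hcomp : IsCompact (closure (range F)) := by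
    refine BoundedContinuousFunction.arzela_ascoli (Metric.closedBall x₀ (K * (b - a)))
      (isCompact_closedBall _ _) _ ?_ ?_
    · rintro _ t ⟨n, rfl⟩
      have h := (hf n).dist_le_mul t t.2 a ⟨le_rfl, hab⟩
      rw [h₀] at h
      refine h.trans (mul_le_mul_of_nonneg_left ?_ K.2)
      rw [Real.dist_eq, abs_of_nonneg (sub_nonneg.2 t.2.1)]
      exact sub_le_sub_right t.2.2 a
    · refine (LipschitzWith.uniformEquicontinuous _ K ?_).equicontinuous
      rintro ⟨_, n, rfl⟩
      exact hF n
  obtain ⟨G, -, k, hk, hG⟩ := hcomp.tendsto_subseq (fun n => subset_closure (mem_range_self n))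
  refine ⟨IccExtend hab G, k, G.continuous.Icc_extend', hk, fun t ht => ?_⟩
  rw [IccExtend_of_mem hab G ht]
  exact (BoundedContinuousFunction.tendsto_iff_tendstoUniformly.1 hG).tendsto_at ⟨t, ht⟩

section Velocity

variable {E : Type*} [NormedAddCommGroup E] [NormedSpace ℝ E] {a b : ℝ} {f g : ℝ → E}

/-- `f` is a `C¹` curve on `[a, b]` with derivative `g`, one-sided at the endpoints. State equations
are put in this form because it survives pointwise limits. -/
structure HasVelocityOn (f g : ℝ → E) (a b : ℝ) : Prop where
  contDiffOn : ContDiffOn ℝ 1 f (Icc a b)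
  derivWithin_eq : ∀ t ∈ Icc a b, derivWithin f (Icc a b) t = g t

theorem HasVelocityOn.continuousOn (h : HasVelocityOn f g a b) : ContinuousOn f (Icc a b) :=
  h.contDiffOn.continuousOn

theorem HasVelocityOn.continuousOn_velocity (hab : a < b) (h : HasVelocityOn f g a b) :
    ContinuousOn g (Icc a b) :=
  (h.contDiffOn.continuousOn_derivWithin (uniqueDiffOn_Icc hab) le_rfl).congr
    fun t ht => (h.derivWithin_eq t ht).symm

theorem HasVelocityOn.lipschitzOnWith {K : NNReal} (h : HasVelocityOn f g a b)
    (hK : ∀ t ∈ Icc a b, ‖g t‖ ≤ K) : LipschitzOnWith K f (Icc a b) :=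
  (convex_Icc a b).lipschitzOnWith_of_nnnorm_derivWithin_le
    (h.contDiffOn.differentiableOn one_ne_zero) fun t ht => by
      rw [h.derivWithin_eq t ht]
      exact hK t ht

variable [CompleteSpace E]

theorem hasVelocityOn_iff_eq_integral (hab : a < b) (hg : ContinuousOn g (Icc a b)) :
    HasVelocityOn f g a b ↔ ∀ t ∈ Icc a b, f t = f a + ∫ s in a..t, g s := by
  constructor
  · intro hf t ht
    have hsub : Icc a t ⊆ Icc a b := Icc_subset_Icc_right ht.2
    rw [intervalIntegral.integral_eq_sub_of_hasDerivAt_of_le ht.1 (hf.continuousOn.mono hsub)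
      (fun s hs => ?_) ((hg.mono hsub).intervalIntegrable_of_Icc ht.1), add_sub_cancel]
    have hs' : s ∈ Icc a b := hsub (Ioo_subset_Icc_self hs)
    rw [← hf.derivWithin_eq s hs']
    exact (hf.contDiffOn.differentiableOn one_ne_zero s hs').hasDerivWithinAt.hasDerivAt
      (Icc_mem_nhds hs.1 (hs.2.trans_le ht.2))
  · intro hf
    have hder : ∀ t ∈ Icc a b, HasDerivWithinAt f (g t) (Icc a b) t := by
      intro t ht
      have : Fact (t ∈ Icc a b) := ⟨ht⟩
      have hint : HasDerivWithinAt (fun t => f a + ∫ s in a..t, g s) (g t) (Icc a b) t :=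
        (intervalIntegral.integral_hasDerivWithinAt_right
          ((hg.mono (Icc_subset_Icc_right ht.2)).intervalIntegrable_of_Icc ht.1)
          (hg.stronglyMeasurableAtFilter_nhdsWithin measurableSet_Icc t) (hg t ht)).const_add _
      exact hint.congr_of_mem hf ht
    have hderiv : ∀ t ∈ Icc a b, derivWithin f (Icc a b) t = g t := fun t ht =>
      (hder t ht).derivWithin (uniqueDiffOn_Icc hab t ht)
    exact ⟨(contDiffOn_one_iff_derivWithin (uniqueDiffOn_Icc hab)).2
      ⟨fun t ht => (hder t ht).differentiableWithinAt, hg.congr hderiv⟩, hderiv⟩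

theorem HasVelocityOn.of_tendsto {ι : Type*} {l : Filter ι} [l.IsCountablyGenerated] [l.NeBot]
    {F G : ι → ℝ → E} {K : ℝ} (hab : a < b) (h : ∀ i, HasVelocityOn (F i) (G i) a b)
    (hK : ∀ i, ∀ t ∈ Icc a b, ‖G i t‖ ≤ K) (hg : ContinuousOn g (Icc a b))
    (hF : ∀ t ∈ Icc a b, Tendsto (fun i => F i t) l (𝓝 (f t)))
    (hG : ∀ t ∈ Icc a b, Tendsto (fun i => G i t) l (𝓝 (g t))) : HasVelocityOn f g a b := by
  have hGc : ∀ i, ContinuousOn (G i) (Icc a b) := fun i => (h i).continuousOn_velocity hab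
  refine (hasVelocityOn_iff_eq_integral hab hg).2 fun t ht => ?_
  have hsub : uIoc a t ⊆ Icc a b := by
    rw [uIoc_of_le ht.1]
    exact Ioc_subset_Icc_self.trans (Icc_subset_Icc_right ht.2)
  have hint : Tendsto (fun i => ∫ s in a..t, G i s) l (𝓝 (∫ s in a..t, g s)) :=
    intervalIntegral.tendsto_integral_filter_of_dominated_convergence (fun _ => K)
      (Eventually.of_forall fun i =>
        ((hGc i).mono hsub).aestronglyMeasurable measurableSet_uIoc)
      (Eventually.of_forall fun i => ae_of_all _ fun s hs => hK i s (hsub hs))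
      intervalIntegrable_const (ae_of_all _ fun s hs => hG s (hsub hs))
  refine tendsto_nhds_unique (hF t ht) ?_
  simp only [fun i => (hasVelocityOn_iff_eq_integral hab (hGc i)).1 (h i) t ht]
  exact (hF a ⟨le_rfl, hab.le⟩).add hint

end Velocity

section StronglyContinuous

variable {Y E F : Type*} [TopologicalSpace Y] [NormedAddCommGroup E] [NormedSpace ℝ E]
  [CompleteSpace E] [NormedAddCommGroup F] [NormedSpace ℝ F] {G : Y → E →L[ℝ] F}

theorem exists_norm_le_of_strongly_continuousOn {K : Set Y} (hK : IsCompact K)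
    (hG : ∀ V, ContinuousOn (fun s => G s V) K) : ∃ M, ∀ s ∈ K, ‖G s‖ ≤ M := by
  obtain ⟨M, hM⟩ := banach_steinhaus (g := fun s : K => G s) fun V => by
    obtain ⟨C, hC⟩ := hK.exists_bound_of_continuousOn (hG V)
    exact ⟨C, fun s => hC s s.2⟩
  exact ⟨M, fun s hs => hM ⟨s, hs⟩⟩

theorem continuous_apply_of_strongly_continuous [WeaklyLocallyCompactSpace Y]
    (hG : ∀ V, Continuous fun s => G s V) : Continuous fun p : Y × E => G p.1 p.2 := by
  refine continuous_iff_continuousAt.2 fun ⟨s, V⟩ => ?_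
  obtain ⟨K, hK, hKs⟩ := exists_compact_mem_nhds s
  obtain ⟨M, hM⟩ := exists_norm_le_of_strongly_continuousOn hK fun V => (hG V).continuousOn
  have hbound : Tendsto (fun p : Y × E => M * ‖p.2 - V‖) (𝓝 (s, V)) (𝓝 0) :=
    (by fun_prop : Continuous fun p : Y × E => M * ‖p.2 - V‖).tendsto' _ _ (by simp)
  have hsmall : Tendsto (fun p : Y × E => G p.1 (p.2 - V)) (𝓝 (s, V)) (𝓝 0) := by
    refine squeeze_zero_norm' ?_ hbound
    filter_upwards [continuous_fst.continuousAt hKs] with p hp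
    exact (G p.1).le_of_opNorm_le (hM _ hp) _
  simpa [ContinuousAt] using hsmall.add (((hG V).tendsto s).comp (continuous_fst.tendsto (s, V)))

end StronglyContinuous

section MildSolution

variable {H : Type*} [NormedAddCommGroup H] [NormedSpace ℝ H]

/-- The mild solution `G(t)V₀ + ∫₀ᵗ G(t - τ)j(τ) dτ` of `V' = A V + j`, `V(0) = V₀`, where `A`
generates the semigroup `G`. -/
def mildSolution (G : ℝ → H →L[ℝ] H) (V₀ : H) (j : ℝ → H) (t : ℝ) : H :=
  G t V₀ + ∫ τ in (0 : ℝ)..t, G (t - τ) (j τ)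

variable {G : ℝ → H →L[ℝ] H} {T C : ℝ} (V₀ : H)

theorem norm_mildSolution_le {M : ℝ} (hM : ∀ t ∈ Icc 0 T, ‖G t‖ ≤ M) {j : ℝ → H}
    (hC : ∀ τ ∈ Icc 0 T, ‖j τ‖ ≤ C) {t : ℝ} (ht : t ∈ Icc 0 T) :
    ‖mildSolution G V₀ j t‖ ≤ M * ‖V₀‖ + M * C * T := by
  have h0 : (0 : ℝ) ∈ Icc 0 T := ⟨le_rfl, ht.1.trans ht.2⟩
  have hM0 : 0 ≤ M := (norm_nonneg _).trans (hM 0 h0)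
  have hC0 : 0 ≤ C := (norm_nonneg _).trans (hC 0 h0)
  refine (norm_add_le _ _).trans (add_le_add ((G t).le_of_opNorm_le (hM t ht) V₀) ?_)
  calc ‖∫ τ in (0 : ℝ)..t, G (t - τ) (j τ)‖ ≤ M * C * |t - 0| := by
        refine intervalIntegral.norm_integral_le_of_norm_le_const fun τ hτ => ?_
        rw [uIoc_of_le ht.1] at hτ
        exact (G _).le_of_opNorm_le_of_le (hM _ ⟨by linarith [hτ.2], by linarith [hτ.1, ht.2]⟩)
          (hC τ ⟨hτ.1.le, hτ.2.trans ht.2⟩)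
    _ ≤ M * C * T := by
        rw [sub_zero, abs_of_nonneg ht.1]
        gcongr
        exact ht.2

theorem mildSolution_comp_max_zero {j : ℝ → H} {t : ℝ} (ht : 0 ≤ t) :
    mildSolution (fun s => G (max s 0)) V₀ j t = mildSolution G V₀ j t := by
  simp only [mildSolution, max_eq_left ht]
  congr 1
  refine intervalIntegral.integral_congr fun τ hτ => ?_
  rw [uIcc_of_le ht] at hτ
  simp only [max_eq_left (sub_nonneg.2 hτ.2)]

variable [CompleteSpace H] {ι : Type*} {l : Filter ι} [l.IsCountablyGenerated] {j : ι → ℝ → H}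
  {j' : ℝ → H} {t : ι → ℝ} {t' : ℝ}

theorem tendsto_convolution_of_strongly_continuous (hG : ∀ V, Continuous fun t => G t V)
    (hj : ∀ i, ContinuousOn (j i) (Icc 0 T)) (hC : ∀ i, ∀ τ ∈ Icc 0 T, ‖j i τ‖ ≤ C)
    (hjlim : ∀ τ ∈ Icc 0 T, Tendsto (fun i => j i τ) l (𝓝 (j' τ)))
    (ht : ∀ᶠ i in l, t i ∈ Icc 0 T) (ht' : t' ∈ Icc 0 T) (htlim : Tendsto t l (𝓝 t')) :
    Tendsto (fun i => ∫ τ in (0 : ℝ)..t i, G (t i - τ) (j i τ)) l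
      (𝓝 (∫ τ in (0 : ℝ)..t', G (t' - τ) (j' τ))) := by
  have hGc := continuous_apply_of_strongly_continuous hG
  obtain ⟨M, hM⟩ := exists_norm_le_of_strongly_continuousOn (isCompact_Icc (a := -T) (b := T))
    fun V => (hG V).continuousOn
  have h0 : (0 : ℝ) ∈ Icc 0 T := ⟨le_rfl, ht'.1.trans ht'.2⟩
  have hcont : ∀ i, ContinuousOn (fun τ => G (t i - τ) (j i τ)) (Icc 0 T) := fun i =>
    hGc.comp_continuousOn (ContinuousOn.prodMk (by fun_prop) (hj i))
  have hint : ∀ i, ∀ a ∈ Icc 0 T, ∀ b ∈ Icc 0 T,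
      IntervalIntegrable (fun τ => G (t i - τ) (j i τ)) volume a b := fun i a ha b hb =>
    ((hcont i).mono (uIcc_subset_Icc ha hb)).intervalIntegrable
  have hbound : ∀ᶠ i in l, ∀ τ ∈ Icc 0 T, ‖G (t i - τ) (j i τ)‖ ≤ M * C :=
    ht.mono fun i hi τ hτ => (G _).le_of_opNorm_le_of_le
      (hM _ ⟨by linarith [hi.1, hτ.2], by linarith [hi.2, hτ.1]⟩) (hC i τ hτ)
  have hsub : ∀ {a b}, a ∈ Icc 0 T → b ∈ Icc 0 T → uIoc a b ⊆ Icc 0 T := fun ha hb =>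
    uIoc_subset_uIcc.trans (uIcc_subset_Icc ha hb)
  have hfixed : Tendsto (fun i => ∫ τ in (0 : ℝ)..t', G (t i - τ) (j i τ)) l
      (𝓝 (∫ τ in (0 : ℝ)..t', G (t' - τ) (j' τ))) := by
    refine intervalIntegral.tendsto_integral_filter_of_dominated_convergence (fun _ => M * C)
      (Eventually.of_forall fun i =>
        ((hcont i).mono (hsub h0 ht')).aestronglyMeasurable measurableSet_uIoc)
      (hbound.mono fun i hi => ae_of_all _ fun τ hτ => hi τ (hsub h0 ht' hτ))
      intervalIntegrable_const (ae_of_all _ fun τ hτ => ?_)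
    exact (hGc.tendsto _).comp
      ((htlim.sub_const τ).prodMk_nhds (hjlim τ (hsub h0 ht' hτ)))
  have hmoving : Tendsto (fun i => ∫ τ in t'..t i, G (t i - τ) (j i τ)) l (𝓝 0) := by
    refine squeeze_zero_norm' ?_ (a := fun i => M * C * |t i - t'|) ?_
    · filter_upwards [hbound, ht] with i hi hti
      exact intervalIntegral.norm_integral_le_of_norm_le_const fun τ hτ => hi τ (hsub ht' hti hτ)
    · simpa using (htlim.sub_const t').abs.const_mul (M * C)
  refine (add_zero (∫ τ in (0 : ℝ)..t', G (t' - τ) (j' τ)) ▸ hfixed.add hmoving).congr' ?_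
  filter_upwards [ht] with i hti
  exact intervalIntegral.integral_add_adjacent_intervals (hint i 0 h0 t' ht') (hint i t' ht' _ hti)

theorem tendsto_mildSolution (hG : ∀ V, ContinuousOn (fun t => G t V) (Ici 0))
    (hj : ∀ i, ContinuousOn (j i) (Icc 0 T)) (hC : ∀ i, ∀ τ ∈ Icc 0 T, ‖j i τ‖ ≤ C)
    (hjlim : ∀ τ ∈ Icc 0 T, Tendsto (fun i => j i τ) l (𝓝 (j' τ)))
    (ht : ∀ᶠ i in l, t i ∈ Icc 0 T) (ht' : t' ∈ Icc 0 T) (htlim : Tendsto t l (𝓝 t')) :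
    Tendsto (fun i => mildSolution G V₀ (j i) (t i)) l (𝓝 (mildSolution G V₀ j' t')) := by
  have hG' : ∀ V, Continuous fun s => G (max s 0) V := fun V =>
    (hG V).comp_continuous (by fun_prop) fun s => le_max_right s 0
  rw [← mildSolution_comp_max_zero V₀ ht'.1]
  refine Tendsto.congr' (ht.mono fun i hi => mildSolution_comp_max_zero V₀ hi.1) ?_
  exact (((hG' V₀).tendsto t').comp htlim).add
    (tendsto_convolution_of_strongly_continuous hG' hj hC hjlim ht ht' htlim)

end MildSolution

/-! ### The potential as a bounded operator of the control -/

section VeryWeakSolution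

theorem continuous_gradient {f : E3 → ℝ} (hf : ContDiff ℝ 1 f) : Continuous (gradient f) :=
  (InnerProductSpace.toDual ℝ E3).symm.continuous.comp (hf.continuous_fderiv one_ne_zero)

theorem hasCompactSupport_gradient {f : E3 → ℝ} (hf : HasCompactSupport f) :
    HasCompactSupport (gradient f) :=
  (hf.fderiv ℝ).comp_left (g := (InnerProductSpace.toDual ℝ E3).symm) (map_zero _)

theorem inner_toLp_right {A F : Type*} [MeasurableSpace A] {μ : Measure A} [NormedAddCommGroup F]
    [InnerProductSpace ℝ F] (f : Lp F 2 μ) {g : A → F} (hg : MemLp g 2 μ) :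
    inner ℝ f (hg.toLp g) = ∫ x, inner ℝ (f x) (g x) ∂μ :=
  integral_congr_ae (hg.coeFn_toLp.mono fun x hx => by simp only [hx])

theorem integral_mul_eq_inner {A : Type*} [MeasurableSpace A] {μ : Measure A} (f g : Lp ℝ 2 μ) :
    ∫ x, f x * g x ∂μ = inner ℝ f g :=
  integral_congr_ae (ae_of_all _ fun x => mul_comm (f x) (g x))

theorem integral_mul_eq_inner_toLp {A : Type*} [MeasurableSpace A] {μ : Measure A} (f : Lp ℝ 2 μ)
    {g : A → ℝ} (hg : MemLp g 2 μ) : ∫ x, f x * g x ∂μ = inner ℝ f (hg.toLp g) := by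
  rw [inner_toLp_right]
  exact integral_congr_ae (ae_of_all _ fun x => mul_comm (f x) (g x))

namespace IsTest

variable {U : Set E3} {ψ χ : E3 → ℝ}

theorem memLp (hψ : IsTest U ψ) (μ : Measure E3) [IsFiniteMeasureOnCompacts μ] : MemLp ψ 2 μ :=
  hψ.1.continuous.memLp_of_hasCompactSupport hψ.2.1

theorem memLp_gradient (hψ : IsTest U ψ) (μ : Measure E3) [IsFiniteMeasureOnCompacts μ] :
    MemLp (gradient ψ) 2 μ :=
  (continuous_gradient (hψ.1.of_le (by simp))).memLp_of_hasCompactSupport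
    (hasCompactSupport_gradient hψ.2.1)

theorem differentiable (hψ : IsTest U ψ) : Differentiable ℝ ψ := hψ.1.differentiable (by simp)

theorem zero : IsTest U (0 : E3 → ℝ) := ⟨contDiff_const, .zero, by simp [tsupport_zero]⟩

theorem add (hψ : IsTest U ψ) (hχ : IsTest U χ) : IsTest U (ψ + χ) :=
  ⟨hψ.1.add hχ.1, hψ.2.1.add hχ.2.1, (tsupport_add ψ χ).trans (union_subset hψ.2.2 hχ.2.2)⟩

theorem smul (c : ℝ) (hψ : IsTest U ψ) : IsTest U (c • ψ) :=
  ⟨hψ.1.const_smul c, hψ.2.1.smul_left (f := fun _ => c),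
    (closure_mono (Function.support_const_smul_subset c ψ)).trans hψ.2.2⟩

end IsTest

variable {Ω : Set E3}

/-- The graph in `L²(Ω) × L²(Ω; ℝ³)` of the gradient on `C_c^∞(Ω)`; its closure is the graph of the
weak gradient on `H¹₀(Ω)`. -/
def testGraph (Ω : Set E3) : Submodule ℝ (L2 Ω × X Ω) where
  carrier := {a | ∃ ψ : E3 → ℝ, IsTest Ω ψ ∧
    a.1 =ᵐ[volume.restrict Ω] ψ ∧ a.2 =ᵐ[volume.restrict Ω] gradient ψ}
  zero_mem' := by
    refine ⟨0, IsTest.zero, Lp.coeFn_zero _ _ _,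
      (Lp.coeFn_zero _ _ _).trans (ae_of_all _ fun x => ?_)⟩
    simp [gradient]
  add_mem' := by
    rintro a b ⟨ψ, hψ, haψ, haψ'⟩ ⟨χ, hχ, hbχ, hbχ'⟩
    refine ⟨ψ + χ, hψ.add hχ, (Lp.coeFn_add _ _).trans (haψ.add hbχ),
      (Lp.coeFn_add _ _).trans ((haψ'.add hbχ').trans (ae_of_all _ fun x => ?_))⟩
    simp [gradient, fderiv_add (hψ.differentiable x) (hχ.differentiable x)]
  smul_mem' := by
    rintro c a ⟨ψ, hψ, haψ, haψ'⟩
    refine ⟨c • ψ, hψ.smul c, (Lp.coeFn_smul _ _).trans (haψ.const_smul c),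
      (Lp.coeFn_smul _ _).trans ((haψ'.const_smul c).trans (ae_of_all _ fun x => ?_))⟩
    simp [gradient, fderiv_const_smul (hψ.differentiable x)]

theorem IsTest.memH10 {ψ : E3 → ℝ} (hψ : IsTest Ω ψ) :
    MemH10 Ω ((hψ.memLp _).toLp ψ) ((hψ.memLp_gradient _).toLp (gradient ψ)) :=
  subset_closure ⟨ψ, hψ, (hψ.memLp _).coeFn_toLp, (hψ.memLp_gradient _).coeFn_toLp⟩

theorem hasDiv_iff {f : X Ω} {d : L2 Ω} :
    HasDiv Ω f d ↔ ∀ ψ (hψ : IsTest Ω ψ), inner ℝ f ((hψ.memLp_gradient _).toLp (gradient ψ)) =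
      -inner ℝ d ((hψ.memLp _).toLp ψ) := by
  refine forall₂_congr fun ψ hψ => ?_
  rw [inner_toLp_right, integral_mul_eq_inner_toLp d (hψ.memLp _)]

theorem hasNormalTrace_iff [IsFiniteMeasureOnCompacts (surface Ω)] {f : X Ω} {d : L2 Ω}
    {h : L2Bdry Ω} :
    HasNormalTrace Ω f d h ↔ ∀ ψ (hψ : IsTest univ ψ), inner ℝ h ((hψ.memLp _).toLp ψ) =
      inner ℝ f ((hψ.memLp_gradient _).toLp (gradient ψ)) + inner ℝ d ((hψ.memLp _).toLp ψ) := by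
  refine forall₂_congr fun ψ hψ => ?_
  rw [inner_toLp_right f, integral_mul_eq_inner_toLp d (hψ.memLp _),
    integral_mul_eq_inner_toLp h (hψ.memLp _)]

theorem solvesWeakPoisson_iff {g : L2 Ω} {Dw : X Ω} :
    SolvesWeakPoisson Ω g Dw ↔ ∀ v Dv, MemH10 Ω v Dv → inner ℝ Dw Dv = inner ℝ g v := by
  refine forall₃_congr fun v Dv _ => ?_
  rw [integral_mul_eq_inner, L2.inner_def Dw]

theorem isVeryWeakSolution_iff {u : L2Bdry Ω} {η : L2 Ω} :
    IsVeryWeakSolution Ω u η ↔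
      ∀ v Dv Lv dn, MemH Ω v Dv Lv dn → inner ℝ η Lv = inner ℝ u dn := by
  refine forall₅_congr fun v Dv Lv dn _ => ?_
  rw [integral_mul_eq_inner, integral_mul_eq_inner, neg_add_eq_zero]

theorem HasDiv.solvesWeakPoisson_neg {f : X Ω} {d : L2 Ω} (hf : HasDiv Ω f d) :
    SolvesWeakPoisson Ω (-d) f := by
  refine solvesWeakPoisson_iff.2 fun v Dv hv => ?_
  have hclosed : IsClosed {a : L2 Ω × X Ω | inner ℝ f a.2 = inner ℝ (-d) a.1} :=
    isClosed_eq (by fun_prop) (by fun_prop)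
  refine closure_minimal ?_ hclosed hv
  rintro ⟨v, Dv⟩ ⟨ψ, hψ, hvψ, hDvψ⟩
  have hv : v = (hψ.memLp _).toLp ψ := Lp.ext (hvψ.trans (hψ.memLp _).coeFn_toLp.symm)
  have hDv : Dv = (hψ.memLp_gradient _).toLp (gradient ψ) :=
    Lp.ext (hDvψ.trans (hψ.memLp_gradient _).coeFn_toLp.symm)
  rw [mem_ofPred_eq, hv, hDv, inner_neg_left]
  exact hasDiv_iff.1 hf ψ hψ

theorem eq_zero_of_forall_inner_isTest_eq_zero (hΩ : IsOpen Ω) {f : L2 Ω}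
    (hf : ∀ ψ (hψ : IsTest Ω ψ), inner ℝ f ((hψ.memLp _).toLp ψ) = 0) : f = 0 := by
  have hloc : LocallyIntegrableOn f Ω volume :=
    locallyIntegrableOn_of_locallyIntegrable_restrict
      ((Lp.memLp f).locallyIntegrable one_le_two)
  have hae := hΩ.ae_eq_zero_of_integral_contDiff_smul_eq_zero hloc fun ψ hsmooth hcpt hsupp => by
    have hψ : IsTest Ω ψ := ⟨hsmooth, hcpt, hsupp⟩
    rw [← hf ψ hψ, ← integral_mul_eq_inner_toLp,
      ← setIntegral_eq_integral_of_forall_compl_eq_zero (s := Ω)]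
    · simp only [smul_eq_mul, mul_comm]
    · intro x hx
      rw [image_eq_zero_of_notMem_tsupport fun hx' => hx (hsupp hx'), zero_smul]
  refine Lp.ext (EventuallyEq.trans ?_ (Lp.coeFn_zero ℝ 2 _).symm)
  exact (ae_restrict_iff' hΩ.measurableSet).2 hae

theorem eq_neg_of_hasDiv_of_solvesWeakPoisson (hΩ : IsOpen Ω) {f : X Ω} {d g : L2 Ω}
    (hf : HasDiv Ω f d) (hg : SolvesWeakPoisson Ω g f) : d = -g := by
  refine eq_neg_of_add_eq_zero_left (eq_zero_of_forall_inner_isTest_eq_zero hΩ fun ψ hψ => ?_)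
  rw [inner_add_left, ← solvesWeakPoisson_iff.1 hg _ _ hψ.memH10, hasDiv_iff.1 hf ψ hψ,
    add_neg_cancel]

/-- The relation between the Laplacian and the normal derivative of the elements of `𝓗`. -/
def fluxRelation (Ω : Set E3) [IsFiniteMeasureOnCompacts (surface Ω)] :
    Submodule ℝ (L2 Ω × L2Bdry Ω) where
  carrier := {a | ∃ v Dv, MemH Ω v Dv a.1 a.2}
  zero_mem' := ⟨0, 0, (testGraph Ω).topologicalClosure.zero_mem, hasDiv_iff.2 fun ψ hψ => by simp,
    hasNormalTrace_iff.2 fun ψ hψ => by simp⟩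
  add_mem' := by
    rintro a b ⟨v, Dv, hv, hdiv, htrace⟩ ⟨v', Dv', hv', hdiv', htrace'⟩
    refine ⟨v + v', Dv + Dv', (testGraph Ω).topologicalClosure.add_mem hv hv',
      hasDiv_iff.2 fun ψ hψ => ?_, hasNormalTrace_iff.2 fun ψ hψ => ?_⟩
    · simp only [Prod.fst_add, inner_add_left, hasDiv_iff.1 hdiv ψ hψ, hasDiv_iff.1 hdiv' ψ hψ]
      ring
    · simp only [Prod.fst_add, Prod.snd_add, inner_add_left, hasNormalTrace_iff.1 htrace ψ hψ,
        hasNormalTrace_iff.1 htrace' ψ hψ]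
      ring
  smul_mem' := by
    rintro c a ⟨v, Dv, hv, hdiv, htrace⟩
    refine ⟨c • v, c • Dv, (testGraph Ω).topologicalClosure.smul_mem c hv,
      hasDiv_iff.2 fun ψ hψ => ?_, hasNormalTrace_iff.2 fun ψ hψ => ?_⟩
    · simp only [Prod.smul_fst, real_inner_smul_left, hasDiv_iff.1 hdiv ψ hψ, mul_neg]
    · simp only [Prod.smul_fst, Prod.smul_snd, real_inner_smul_left,
        hasNormalTrace_iff.1 htrace ψ hψ, mul_add]

variable [IsFiniteMeasureOnCompacts (surface Ω)]

theorem PoissonRegular.exists_fluxOperator (hΩ : IsOpen Ω) (h : PoissonRegular Ω) :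
    ∃ S : L2 Ω →L[ℝ] L2Bdry Ω, ∀ g d, (g, d) ∈ fluxRelation Ω ↔ S g = d := by
  obtain ⟨hsolve, C, -, hC⟩ := h
  refine exists_clm_of_submodule (C := C) _ ?_ fun g => ?_
  · rintro g d ⟨v, Dv, hv⟩
    have hbound := hC _ v Dv g d hv hv.2.1.solvesWeakPoisson_neg
    rw [norm_neg] at hbound
    refine (Real.le_sqrt_of_sq_le ?_).trans hbound
    exact le_add_of_nonneg_left (by positivity)
  · obtain ⟨v, ⟨Dv, Lv, d, hv, hpoisson⟩, -⟩ := hsolve (-g)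
    have hLv : Lv = g := by
      simpa using eq_neg_of_hasDiv_of_solvesWeakPoisson hΩ hv.2.1 hpoisson
    exact ⟨d, v, Dv, hLv ▸ hv⟩

theorem PoissonRegular.exists_isVeryWeakSolution_iff (hΩ : IsOpen Ω) (h : PoissonRegular Ω) :
    ∃ Λ : L2Bdry Ω →L[ℝ] L2 Ω, ∀ u η, IsVeryWeakSolution Ω u η ↔ η = Λ u := by
  obtain ⟨S, hS⟩ := h.exists_fluxOperator hΩ
  refine ⟨ContinuousLinearMap.adjoint S, fun u η => isVeryWeakSolution_iff.trans ⟨fun hη => ?_, ?_⟩⟩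
  · refine ext_inner_right ℝ fun g => ?_
    obtain ⟨v, Dv, hv⟩ := (hS g _).2 rfl
    rw [ContinuousLinearMap.adjoint_inner_left]
    exact hη v Dv g _ hv
  · rintro rfl v Dv g d hv
    rw [ContinuousLinearMap.adjoint_inner_left, (hS g d).1 ⟨v, Dv, hv⟩]

theorem PoissonRegular.exists_potential_eq (hΩ : IsOpen Ω) (h : PoissonRegular Ω) :
    ∃ Λ : L2Bdry Ω →L[ℝ] L2 Ω, potential Ω = Λ := by
  obtain ⟨Λ, hΛ⟩ := h.exists_isVeryWeakSolution_iff hΩ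
  refine ⟨Λ, funext fun u => ?_⟩
  have hex : ∃ η, IsVeryWeakSolution Ω u η := ⟨Λ u, (hΛ u _).2 rfl⟩
  rw [potential, dif_pos hex]
  exact (hΛ u _).1 hex.choose_spec

end VeryWeakSolution

/-! ### Electromagnetic field and force -/

section Translates

variable {V F : Type*} [NormedAddCommGroup V] [MeasurableSpace V] [BorelSpace V]
  [SecondCountableTopology V] [NormedAddCommGroup F] [NormedSpace ℝ F]

theorem exists_continuous_translate_toLp (p : ENNReal) [Fact (1 ≤ p)] (μ : Measure V)
    [IsFiniteMeasure μ] {f : V → F} (hf : Continuous f) (hsupp : HasCompactSupport f) :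
    ∃ τ : V → Lp F p μ, Continuous τ ∧ (∃ C, ∀ a, ‖τ a‖ ≤ C) ∧
      ∀ a, τ a =ᵐ[μ] fun x => f (x - a) := by
  obtain ⟨C, hC⟩ := hsupp.exists_bound_of_continuous hf
  let τ₀ : V → BoundedContinuousFunction V F := fun a =>
    .ofNormedAddCommGroup (fun x => f (x - a)) (by fun_prop) C fun x => hC _
  have hτ₀ : Continuous τ₀ := by
    refine continuous_iff_continuousAt.2 fun a => ?_
    refine BoundedContinuousFunction.tendsto_iff_tendstoUniformly.2 ?_
    refine Metric.tendstoUniformly_iff.2 fun ε hε => ?_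
    obtain ⟨δ, hδ, h⟩ := Metric.uniformContinuous_iff.1
      (hsupp.uniformContinuous_of_continuous hf) ε hε
    filter_upwards [Metric.ball_mem_nhds a hδ] with b hb x
    refine h ?_
    rwa [dist_sub_left, dist_comm]
  have hC₀ : 0 ≤ C := (norm_nonneg _).trans (hC 0)
  let L : BoundedContinuousFunction V F →L[ℝ] Lp F p μ := BoundedContinuousFunction.toLp p μ ℝ
  exact ⟨fun a => L (τ₀ a), L.continuous.comp hτ₀,
    ⟨‖L‖ * C, fun a => L.le_opNorm_of_le
      (BoundedContinuousFunction.norm_ofNormedAddCommGroup_le _ hC₀ _)⟩,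
    fun a => BoundedContinuousFunction.coeFn_toLp p μ ℝ (τ₀ a)⟩

end Translates

theorem toX_eq_of_ae_eq {Ω : Set E3} {f : E3 → E3} {g : X Ω}
    (h : g =ᵐ[volume.restrict Ω] f) : toX Ω f = g := by
  have hf : MemLp f 2 (volume.restrict Ω) := (Lp.memLp g).ae_eq h
  rw [toX, dif_pos hf]
  exact Lp.ext (hf.coeFn_toLp.trans h.symm)

theorem continuousOn_maxwellSemigroup (Ω : Set E3) (V : X Ω × X Ω) :
    ContinuousOn (fun t => maxwellSemigroup Ω t V) (Ici 0) := by
  by_cases h : ∃ G, IsMaxwellSemigroup Ω G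
  · rw [maxwellSemigroup, dif_pos h]
    exact h.choose_spec.1.cont V
  · rw [maxwellSemigroup, dif_neg h]
    exact continuousOn_const

/-- The cross product of `ℝ³` as a continuous bilinear map. -/
def crossL : E3 →L[ℝ] E3 →L[ℝ] E3 :=
  IsBilinearMap.toContinuousBilinearMap (f := cross)
    { add_left := fun a b d => by simp [cross]
      smul_left := fun r a d => by simp [cross]
      add_right := fun a b d => by simp [cross]
      smul_right := fun r a d => by simp [cross] }

theorem crossL_apply (a b : E3) : crossL a b = cross a b := rfl

/-- The multiplication of a scalar density in `L²(Ω)` with a constant vector. -/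
def smulConstL (Ω : Set E3) [IsFiniteMeasure (volume.restrict Ω)] : L2 Ω →L[ℝ] E3 →L[ℝ] X Ω :=
  (((ContinuousLinearMap.lsmul ℝ ℝ).holderL (volume.restrict Ω) 2 ⊤ 2).flip ∘L
    Lp.constL ⊤ (volume.restrict Ω) ℝ).flip

theorem coeFn_smulConstL {Ω : Set E3} [IsFiniteMeasure (volume.restrict Ω)] (η : L2 Ω) (d : E3) :
    smulConstL Ω η d =ᵐ[volume.restrict Ω] fun x => η x • d := by
  filter_upwards [(ContinuousLinearMap.lsmul ℝ ℝ).coeFn_holder (r := 2) η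
    (Lp.const ⊤ (volume.restrict Ω) d), Lp.coeFn_const (E := E3) ⊤ (volume.restrict Ω) d]
    with x h h'
  refine h.trans ?_
  rw [h']
  rfl

namespace ProblemData

/-- Data to which the direct method applies: a regular Poisson problem, a `C¹` charge density whose
support stays inside `Ω` along admissible positions, and continuous constraints and costs. -/
structure ExistenceAssumptions (P : ProblemData) : Prop where
  isOpen : IsOpen P.Ω
  isBounded : Bornology.IsBounded P.Ω
  surface_finite : surface P.Ω univ < ⊤
  poissonRegular : PoissonRegular P.Ω
  T_pos : 0 < P.T
  c_pos : 0 < P.c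
  m₀_pos : 0 < P.m₀
  α_pos : 0 < P.α
  φ_contDiff : ContDiff ℝ 1 P.φ
  φ_support : tsupport P.φ ⊆ Metric.closedBall 0 P.R
  g_continuous : ∀ i, Continuous (P.g i)
  admissible_subset : P.admissible ⊆ P.Ω
  admissible_dist : ∀ x ∈ P.admissible, ∀ y ∈ frontier P.Ω, P.R < dist x y
  J₁_continuous : Continuous P.J₁
  J₂_continuous : Continuous P.J₂
  J₁_bddBelow : ∃ c₁ : ℝ, ∀ x, c₁ ≤ P.J₁ x
  J₂_bddBelow : ∃ c₂ : ℝ, ∀ x, c₂ ≤ P.J₂ x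

variable {P : ProblemData}

theorem StandingAssumptions.existenceAssumptions (hP : P.StandingAssumptions) :
    P.ExistenceAssumptions where
  __ := hP
  φ_contDiff := hP.φ_contDiff.of_le one_le_two
  g_continuous i := (hP.g_contDiff i).continuous
  J₁_continuous := hP.J₁_contDiff.continuous
  J₂_continuous := hP.J₂_contDiff.continuous

namespace ExistenceAssumptions

theorem isFiniteMeasure_volume (hP : P.ExistenceAssumptions) :
    IsFiniteMeasure (volume.restrict P.Ω) :=
  isFiniteMeasure_restrict.2 hP.isBounded.measure_lt_top.ne

theorem isFiniteMeasure_surface (hP : P.ExistenceAssumptions) : IsFiniteMeasure (surface P.Ω) :=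
  ⟨hP.surface_finite⟩

theorem hasCompactSupport_φ (hP : P.ExistenceAssumptions) : HasCompactSupport P.φ :=
  (isCompact_closedBall 0 P.R).of_isClosed_subset (isClosed_tsupport _) hP.φ_support

theorem φ_sub_eq_zero (hP : P.ExistenceAssumptions) {a x : E3} (ha : a ∈ P.admissible)
    (hx : x ∈ frontier P.Ω) : P.φ (x - a) = 0 := by
  refine image_eq_zero_of_notMem_tsupport fun h => ?_
  have hdist : dist a x ≤ P.R := by
    rw [dist_comm, dist_eq_norm]
    exact mem_closedBall_zero_iff.1 (hP.φ_support h)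
  exact (hP.admissible_dist a ha x hx).not_ge hdist

theorem exists_translate_φ (hP : P.ExistenceAssumptions) :
    ∃ τ : E3 → L2 P.Ω, Continuous τ ∧ (∃ C, ∀ a, ‖τ a‖ ≤ C) ∧
      ∀ a, τ a =ᵐ[volume.restrict P.Ω] fun x => P.φ (x - a) :=
  have := hP.isFiniteMeasure_volume
  exists_continuous_translate_toLp 2 _ hP.φ_contDiff.continuous hP.hasCompactSupport_φ

theorem exists_translate_gradient_φ (hP : P.ExistenceAssumptions) :
    ∃ τ : E3 → X P.Ω, Continuous τ ∧ (∃ C, ∀ a, ‖τ a‖ ≤ C) ∧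
      ∀ a, τ a =ᵐ[volume.restrict P.Ω] fun x => gradient P.φ (x - a) :=
  have := hP.isFiniteMeasure_volume
  exists_continuous_translate_toLp 2 _ (continuous_gradient hP.φ_contDiff)
    (hasCompactSupport_gradient hP.hasCompactSupport_φ)

end ExistenceAssumptions

theorem one_le_γ (p : E3) : 1 ≤ P.γ p :=
  Real.one_le_sqrt.2 (le_add_of_nonneg_right (by positivity))

theorem continuous_γ : Continuous P.γ := by
  unfold γ
  fun_prop

theorem continuous_v (hm : P.m₀ ≠ 0) : Continuous P.v :=
  ((continuous_const.mul continuous_γ).inv₀ fun p =>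
    mul_ne_zero hm (zero_lt_one.trans_le (one_le_γ p)).ne').smul continuous_id

theorem continuous_β (hm : P.m₀ ≠ 0) : Continuous P.β := by
  have hv := continuous_v hm
  unfold β
  fun_prop

theorem norm_v_le (hm : 0 < P.m₀) (hc : 0 < P.c) (p : E3) : ‖P.v p‖ ≤ P.c := by
  have hγ : 0 < P.γ p := zero_lt_one.trans_le (one_le_γ p)
  have hp : ‖p‖ / (P.m₀ * P.c) ≤ P.γ p :=
    Real.le_sqrt_of_sq_le (by rw [div_pow]; exact le_add_of_nonneg_left zero_le_one)
  rw [div_le_iff₀ (by positivity)] at hp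
  rw [v, norm_smul, norm_inv, Real.norm_of_nonneg (by positivity), inv_mul_le_iff₀ (by positivity)]
  exact hp.trans_eq (by ring)

theorem norm_β_le (hm : 0 < P.m₀) (hc : 0 < P.c) (p : E3) : ‖P.β p‖ ≤ 1 := by
  rw [β, norm_smul, norm_inv, Real.norm_of_nonneg hc.le, inv_mul_le_iff₀ hc, mul_one]
  exact norm_v_le hm hc p

/-- The current density of a particle with position `a` and momentum `b`. -/
def currentAt (P : ProblemData) (a b : E3) : X P.Ω × X P.Ω :=
  (toX P.Ω fun x => -(P.q * P.φ (x - a)) • P.v b, 0)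

theorem currentAt_eq [IsFiniteMeasure (volume.restrict P.Ω)] {a : E3} {φₐ : L2 P.Ω}
    (hφₐ : φₐ =ᵐ[volume.restrict P.Ω] fun x => P.φ (x - a)) (b : E3) :
    P.currentAt a b = (-P.q • smulConstL P.Ω φₐ (P.v b), 0) := by
  rw [currentAt, toX_eq_of_ae_eq]
  filter_upwards [Lp.coeFn_smul (-P.q) (smulConstL P.Ω φₐ (P.v b)),
    coeFn_smulConstL φₐ (P.v b), hφₐ] with x hsmul hconst hx
  rw [hsmul, Pi.smul_apply, hconst, hx, smul_smul, neg_mul]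

namespace ExistenceAssumptions

theorem continuous_currentAt (hP : P.ExistenceAssumptions) :
    Continuous fun y : E3 × E3 => P.currentAt y.1 y.2 := by
  have := hP.isFiniteMeasure_volume
  have hv := continuous_v hP.m₀_pos.ne'
  obtain ⟨τ, hτ, -, hτφ⟩ := hP.exists_translate_φ
  simp only [fun y : E3 × E3 => currentAt_eq (hτφ y.1) y.2]
  fun_prop

theorem exists_norm_currentAt_le (hP : P.ExistenceAssumptions) :
    ∃ C, ∀ a b, ‖P.currentAt a b‖ ≤ C := by
  have := hP.isFiniteMeasure_volume
  obtain ⟨τ, -, ⟨C, hC⟩, hτφ⟩ := hP.exists_translate_φ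
  refine ⟨‖-P.q‖ * (‖smulConstL P.Ω‖ * C * P.c), fun a b => ?_⟩
  rw [currentAt_eq (hτφ a), Prod.norm_mk, norm_zero, max_eq_left (norm_nonneg _), norm_smul]
  gcongr
  exact (smulConstL P.Ω).le_of_opNorm₂_le_of_le le_rfl (hC a) (norm_v_le hP.m₀_pos hP.c_pos b)

theorem exists_norm_field_le (hP : P.ExistenceAssumptions) :
    ∃ C, ∀ r p, ∀ t ∈ Icc 0 P.T, ‖P.field r p t‖ ≤ C := by
  obtain ⟨M, hM⟩ := exists_norm_le_of_strongly_continuousOn (isCompact_Icc (a := 0) (b := P.T))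
    fun V => (continuousOn_maxwellSemigroup P.Ω V).mono Icc_subset_Ici_self
  obtain ⟨C, hC⟩ := hP.exists_norm_currentAt_le
  exact ⟨M * ‖(P.E₀, P.B₀)‖ + M * C * P.T, fun r p t ht =>
    norm_mildSolution_le _ hM (fun τ _ => hC (r τ) (p τ)) ht⟩

theorem continuousOn_current (hP : P.ExistenceAssumptions) {r p : ℝ → E3} {s : Set ℝ}
    (hr : ContinuousOn r s) (hp : ContinuousOn p s) : ContinuousOn (P.current r p) s := by
  have hcomp := hP.continuous_currentAt.comp_continuousOn (hr.prodMk hp)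
  exact hcomp

theorem tendsto_current {ι : Type*} {l : Filter ι} (hP : P.ExistenceAssumptions)
    {r p : ι → ℝ → E3} {r' p' : ℝ → E3} {t : ℝ} (hr : Tendsto (fun i => r i t) l (𝓝 (r' t)))
    (hp : Tendsto (fun i => p i t) l (𝓝 (p' t))) :
    Tendsto (fun i => P.current (r i) (p i) t) l (𝓝 (P.current r' p' t)) := by
  have hcomp := (hP.continuous_currentAt.tendsto (r' t, p' t)).comp (hr.prodMk_nhds hp)
  exact hcomp

theorem tendsto_field {ι : Type*} {l : Filter ι} [l.IsCountablyGenerated]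
    (hP : P.ExistenceAssumptions) {r p : ι → ℝ → E3} {r' p' : ℝ → E3} {t : ι → ℝ} {t' : ℝ}
    (hr : ∀ i, ContinuousOn (r i) (Icc 0 P.T)) (hp : ∀ i, ContinuousOn (p i) (Icc 0 P.T))
    (hr' : ∀ s ∈ Icc 0 P.T, Tendsto (fun i => r i s) l (𝓝 (r' s)))
    (hp' : ∀ s ∈ Icc 0 P.T, Tendsto (fun i => p i s) l (𝓝 (p' s)))
    (ht : ∀ᶠ i in l, t i ∈ Icc 0 P.T) (ht' : t' ∈ Icc 0 P.T) (htlim : Tendsto t l (𝓝 t')) :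
    Tendsto (fun i => P.field (r i) (p i) (t i)) l (𝓝 (P.field r' p' t')) := by
  obtain ⟨C, hC⟩ := hP.exists_norm_currentAt_le
  exact tendsto_mildSolution (P.E₀, P.B₀) (continuousOn_maxwellSemigroup P.Ω)
    (fun i => hP.continuousOn_current (hr i) (hp i)) (fun i s _ => hC (r i s) (p i s))
    (fun s hs => hP.tendsto_current (hr' s hs) (hp' s hs)) ht ht' htlim

end ExistenceAssumptions

end ProblemData

/-- The pairing `∫_Ω η f ∈ ℝ³` of a scalar `η ∈ L²(Ω)` with a vector field `f ∈ L²(Ω; ℝ³)`. -/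
def pairing (Ω : Set E3) : L2 Ω →L[ℝ] X Ω →L[ℝ] E3 :=
  (ContinuousLinearMap.lsmul ℝ ℝ).lpPairing (volume.restrict Ω) 2 2

theorem pairing_eq_integral {Ω : Set E3} {η : L2 Ω} {f : X Ω} {η' : E3 → ℝ} {f' : E3 → E3}
    (hη : η =ᵐ[volume.restrict Ω] η') (hf : f =ᵐ[volume.restrict Ω] f') :
    pairing Ω η f = ∫ x in Ω, η' x • f' x := by
  rw [pairing, ContinuousLinearMap.lpPairing_eq_integral]
  refine integral_congr_ae ?_
  filter_upwards [hη, hf] with x hηx hfx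
  rw [hηx, hfx, ContinuousLinearMap.lsmul_apply]

theorem integrable_smul_coeFn {Ω : Set E3} (η : L2 Ω) (f : X Ω) :
    Integrable (fun x => η x • f x) (volume.restrict Ω) :=
  memLp_one_iff_integrable.1 ((Lp.memLp f).smul (Lp.memLp η))

namespace ProblemData

variable {P : ProblemData}

/-- The force on a particle with position `a` and momentum `b` in the electromagnetic field `V` and
the external field with potential `η`, when the charge distribution does not meet the boundary. -/
def force (P : ProblemData) (a b : E3) (V : X P.Ω × X P.Ω) (η : L2 P.Ω) : E3 :=
  P.q • ((∫ x in P.Ω, P.φ (x - a) • V.1 x) + cross (P.β b) (∫ x in P.Ω, P.φ (x - a) • V.2 x)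
    - cross (∫ x in P.Ω, η x • gradient P.φ (x - a)) (P.β b))

theorem force_eq_pairing {a : E3} {φₐ : L2 P.Ω} {ψₐ : X P.Ω}
    (hφₐ : φₐ =ᵐ[volume.restrict P.Ω] fun x => P.φ (x - a))
    (hψₐ : ψₐ =ᵐ[volume.restrict P.Ω] fun x => gradient P.φ (x - a)) (b : E3) (V : X P.Ω × X P.Ω)
    (η : L2 P.Ω) :
    P.force a b V η = P.q • (pairing P.Ω φₐ V.1 + crossL (P.β b) (pairing P.Ω φₐ V.2)
      - crossL (pairing P.Ω η ψₐ) (P.β b)) := by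
  rw [pairing_eq_integral hφₐ .rfl, pairing_eq_integral hφₐ .rfl, pairing_eq_integral .rfl hψₐ]
  rfl

namespace ExistenceAssumptions

theorem exists_norm_force_le (hP : P.ExistenceAssumptions) (CV Cη : ℝ) :
    ∃ K, ∀ a b V η, ‖V‖ ≤ CV → ‖η‖ ≤ Cη → ‖P.force a b V η‖ ≤ K := by
  obtain ⟨φₐ, -, ⟨Cφ, hCφ⟩, hφₐ⟩ := hP.exists_translate_φ
  obtain ⟨ψₐ, -, ⟨Cψ, hCψ⟩, hψₐ⟩ := hP.exists_translate_gradient_φ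
  let D := ‖pairing P.Ω‖
  refine ⟨‖P.q‖ * (D * Cφ * CV + ‖crossL‖ * 1 * (D * Cφ * CV) + ‖crossL‖ * (D * Cη * Cψ) * 1),
    fun a b V η hV hη => ?_⟩
  have hβ : ‖P.β b‖ ≤ 1 := norm_β_le hP.m₀_pos hP.c_pos b
  have hpair : ∀ f : X P.Ω, ‖f‖ ≤ CV → ‖pairing P.Ω (φₐ a) f‖ ≤ D * Cφ * CV := fun f hf =>
    (pairing P.Ω).le_of_opNorm₂_le_of_le le_rfl (hCφ a) hf
  rw [force_eq_pairing (hφₐ a) (hψₐ a), norm_smul]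
  gcongr
  refine norm_sub_le_of_le (norm_add_le_of_le (hpair _ ((norm_fst_le V).trans hV)) ?_) ?_
  · exact crossL.le_of_opNorm₂_le_of_le le_rfl hβ (hpair _ ((norm_snd_le V).trans hV))
  · exact crossL.le_of_opNorm₂_le_of_le le_rfl
      ((pairing P.Ω).le_of_opNorm₂_le_of_le le_rfl hη (hCψ a)) hβ

theorem tendsto_force {ι : Type*} {l : Filter ι} (hP : P.ExistenceAssumptions) {a b : ι → E3}
    {V : ι → X P.Ω × X P.Ω} {η : ι → L2 P.Ω} {a' b' : E3} {V' : X P.Ω × X P.Ω} {η' : L2 P.Ω}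
    {C : ℝ} (ha : Tendsto a l (𝓝 a')) (hb : Tendsto b l (𝓝 b')) (hV : Tendsto V l (𝓝 V'))
    (hη : Tendsto (fun i => toWeakSpace ℝ (L2 P.Ω) (η i)) l (𝓝 (toWeakSpace ℝ (L2 P.Ω) η')))
    (hC : ∀ i, ‖η i‖ ≤ C) :
    Tendsto (fun i => P.force (a i) (b i) (V i) (η i)) l (𝓝 (P.force a' b' V' η')) := by
  obtain ⟨φₐ, hφc, -, hφₐ⟩ := hP.exists_translate_φ
  obtain ⟨ψₐ, hψc, -, hψₐ⟩ := hP.exists_translate_gradient_φ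
  have hβ : Continuous P.β := continuous_β hP.m₀_pos.ne'
  have hηψ : Tendsto (fun i => pairing P.Ω (η i) (ψₐ (a i))) l (𝓝 (pairing P.Ω η' (ψₐ a'))) :=
    tendsto_apply_apply_of_tendsto_toWeakSpace hη hC (pairing P.Ω) ((hψc.tendsto a').comp ha)
  have hcont : Continuous fun y : E3 × E3 × (X P.Ω × X P.Ω) × E3 =>
      P.q • (pairing P.Ω (φₐ y.1) y.2.2.1.1 + crossL (P.β y.2.1) (pairing P.Ω (φₐ y.1) y.2.2.1.2)
        - crossL y.2.2.2 (P.β y.2.1)) := by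
    fun_prop
  have hlim := (hcont.tendsto _).comp
    (ha.prodMk_nhds (hb.prodMk_nhds (hV.prodMk_nhds hηψ)))
  simp only [fun a => force_eq_pairing (hφₐ a) (hψₐ a)]
  exact hlim

end ExistenceAssumptions

/-- The acceleration `ż(t)` prescribed by the momentum equation along the curves `w` and `z` in the
external field with potential `η`. -/
def acceleration (P : ProblemData) (w z : ℝ → E3) (η : L2 P.Ω) (t : ℝ) : E3 :=
  P.force (w t + P.r₀) (z t + P.p₀) (P.field (fun s => w s + P.r₀) (fun s => z s + P.p₀) t) η

namespace ExistenceAssumptions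

theorem integral_smul_lorentz (hP : P.ExistenceAssumptions) (a d : E3) (V : X P.Ω × X P.Ω) :
    ∫ x in P.Ω, P.φ (x - a) • (V.1 x + cross d (V.2 x)) =
      (∫ x in P.Ω, P.φ (x - a) • V.1 x) + cross d (∫ x in P.Ω, P.φ (x - a) • V.2 x) := by
  obtain ⟨φₐ, -, -, hφₐ⟩ := hP.exists_translate_φ
  have hint (f : X P.Ω) : Integrable (fun x => P.φ (x - a) • f x) (volume.restrict P.Ω) :=
    (integrable_smul_coeFn (φₐ a) f).congr ((hφₐ a).smul .rfl)
  simp only [← crossL_apply, smul_add, ← map_smul]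
  rw [integral_add (hint V.1) ((crossL d).integrable_comp (hint V.2)),
    (crossL d).integral_comp_comm (hint V.2)]

theorem integral_smul_cross_gradient (hP : P.ExistenceAssumptions) (a d : E3) (η : L2 P.Ω) :
    ∫ x in P.Ω, η x • cross (gradient P.φ (x - a)) d =
      cross (∫ x in P.Ω, η x • gradient P.φ (x - a)) d := by
  obtain ⟨ψₐ, -, -, hψₐ⟩ := hP.exists_translate_gradient_φ
  have hint : Integrable (fun x => η x • gradient P.φ (x - a)) (volume.restrict P.Ω) :=
    (integrable_smul_coeFn η (ψₐ a)).congr (.smul .rfl (hψₐ a))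
  simp only [← crossL_apply, ← ContinuousLinearMap.flip_apply crossL _ d, ← map_smul]
  exact (crossL.flip d).integral_comp_comm hint

theorem integral_surface_eq_zero (hP : P.ExistenceAssumptions) {a : E3} (ha : a ∈ P.admissible)
    (u : E3 → ℝ) (f : E3 → E3) : ∫ x, (u x * P.φ (x - a)) • f x ∂(surface P.Ω) = 0 :=
  setIntegral_eq_zero_of_forall_eq_zero fun x hx => by
    rw [hP.φ_sub_eq_zero ha hx, mul_zero, zero_smul]

theorem e₁_eq (hP : P.ExistenceAssumptions) {w z : ℝ → E3} {u : L2Bdry P.Ω} {t : ℝ}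
    (ht : w t + P.r₀ ∈ P.admissible) :
    P.e₁ w z u t = derivWithin z (Icc 0 P.T) t - P.acceleration w z (potential P.Ω u) t := by
  simp only [e₁, lorentz, acceleration, force, sub_sub _ (w t) P.r₀]
  rw [hP.integral_smul_lorentz, hP.integral_smul_cross_gradient,
    hP.integral_surface_eq_zero ht, smul_zero, sub_zero, smul_sub]
  abel

theorem exists_norm_acceleration_le (hP : P.ExistenceAssumptions) (C : ℝ) :
    ∃ K, ∀ w z η, ‖η‖ ≤ C → ∀ t ∈ Icc 0 P.T, ‖P.acceleration w z η t‖ ≤ K := by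
  obtain ⟨CV, hCV⟩ := hP.exists_norm_field_le
  obtain ⟨K, hK⟩ := hP.exists_norm_force_le CV C
  exact ⟨K, fun w z η hη t ht => hK _ _ _ _ (hCV _ _ t ht) hη⟩

theorem continuousOn_acceleration (hP : P.ExistenceAssumptions) {w z : ℝ → E3}
    (hw : ContinuousOn w (Icc 0 P.T)) (hz : ContinuousOn z (Icc 0 P.T)) (η : L2 P.Ω) :
    ContinuousOn (P.acceleration w z η) (Icc 0 P.T) := fun t ht =>
  hP.tendsto_force ((hw t ht).add_const _) ((hz t ht).add_const _)
    (hP.tendsto_field (fun _ => hw.add continuousOn_const) (fun _ => hz.add continuousOn_const)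
      (fun _ _ => tendsto_const_nhds) (fun _ _ => tendsto_const_nhds) self_mem_nhdsWithin ht
      (tendsto_id.mono_left nhdsWithin_le_nhds))
    tendsto_const_nhds fun _ => le_rfl

theorem tendsto_acceleration {ι : Type*} {l : Filter ι} [l.IsCountablyGenerated]
    (hP : P.ExistenceAssumptions) {w z : ι → ℝ → E3} {w' z' : ℝ → E3} {η : ι → L2 P.Ω}
    {η' : L2 P.Ω} {C t : ℝ}
    (hwc : ∀ i, ContinuousOn (w i) (Icc 0 P.T)) (hzc : ∀ i, ContinuousOn (z i) (Icc 0 P.T))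
    (hw : ∀ s ∈ Icc 0 P.T, Tendsto (fun i => w i s) l (𝓝 (w' s)))
    (hz : ∀ s ∈ Icc 0 P.T, Tendsto (fun i => z i s) l (𝓝 (z' s)))
    (hη : Tendsto (fun i => toWeakSpace ℝ (L2 P.Ω) (η i)) l (𝓝 (toWeakSpace ℝ (L2 P.Ω) η')))
    (hC : ∀ i, ‖η i‖ ≤ C) (ht : t ∈ Icc 0 P.T) :
    Tendsto (fun i => P.acceleration (w i) (z i) (η i) t) l
      (𝓝 (P.acceleration w' z' η' t)) :=
  hP.tendsto_force ((hw t ht).add_const _) ((hz t ht).add_const _)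
    (hP.tendsto_field (fun i => (hwc i).add continuousOn_const)
      (fun i => (hzc i).add continuousOn_const) (fun s hs => (hw s hs).add_const _)
      (fun s hs => (hz s hs).add_const _) (Eventually.of_forall fun _ => ht) ht tendsto_const_nhds)
    hη hC

end ExistenceAssumptions

end ProblemData

/-! ### Limits of feasible triples -/

namespace ProblemData

variable {P : ProblemData}

theorem StateConstraint.mem_admissible {w : ℝ → E3} (h : P.StateConstraint w) {t : ℝ}
    (ht : t ∈ Icc 0 P.T) : w t + P.r₀ ∈ P.admissible := fun i => h i t ht

theorem objective_eq (r : ℝ → E3) (u : L2Bdry P.Ω) : P.objective r u =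
    (∫ t in (0 : ℝ)..P.T, P.J₁ (r t)) + P.J₂ (r P.T) + P.α / 2 * ‖u‖ ^ 2 := by
  rw [objective, ← real_inner_self_eq_norm_sq, ← integral_mul_eq_inner]
  simp only [sq]

namespace ExistenceAssumptions

theorem feasible_iff (hP : P.ExistenceAssumptions) {w z : ℝ → E3} {u : L2Bdry P.Ω} :
    P.Feasible w z u ↔ w 0 = 0 ∧ z 0 = 0 ∧ P.StateConstraint w ∧
      HasVelocityOn w (fun t => P.v (z t + P.p₀)) 0 P.T ∧
      HasVelocityOn z (P.acceleration w z (potential P.Ω u)) 0 P.T := by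
  constructor
  · rintro ⟨⟨⟨hw, hw₀⟩, ⟨hz, hz₀⟩, hstate⟩, hc⟩
    refine ⟨hw₀, hz₀, hc, ⟨hw, fun t ht => ?_⟩, ⟨hz, fun t ht => ?_⟩⟩
    · exact sub_eq_zero.1 (hstate t ht).2
    · rw [← sub_eq_zero, ← hP.e₁_eq (hc.mem_admissible ht)]
      exact (hstate t ht).1
  · rintro ⟨hw₀, hz₀, hc, hw, hz⟩
    refine ⟨⟨⟨hw.contDiffOn, hw₀⟩, ⟨hz.contDiffOn, hz₀⟩, fun t ht => ⟨?_, ?_⟩⟩, hc⟩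
    · rw [hP.e₁_eq (hc.mem_admissible ht), hz.derivWithin_eq t ht, sub_self]
    · rw [e₂, hw.derivWithin_eq t ht, sub_self]

theorem exists_potential_eq (hP : P.ExistenceAssumptions) :
    ∃ Λ : L2Bdry P.Ω →L[ℝ] L2 P.Ω, potential P.Ω = Λ :=
  have := hP.isFiniteMeasure_surface
  hP.poissonRegular.exists_potential_eq hP.isOpen

theorem exists_norm_acceleration_potential_le (hP : P.ExistenceAssumptions) (C : ℝ) :
    ∃ K, ∀ w z (u : L2Bdry P.Ω), ‖u‖ ≤ C → ∀ t ∈ Icc 0 P.T,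
      ‖P.acceleration w z (potential P.Ω u) t‖ ≤ K := by
  obtain ⟨Λ, hΛ⟩ := hP.exists_potential_eq
  obtain ⟨K, hK⟩ := hP.exists_norm_acceleration_le (‖Λ‖ * C)
  refine ⟨K, fun w z u hu => hK w z _ ?_⟩
  rw [hΛ]
  exact Λ.le_opNorm_of_le hu

theorem feasible_of_tendsto (hP : P.ExistenceAssumptions) {w z : ℕ → ℝ → E3} {w' z' : ℝ → E3}
    {u : ℕ → L2Bdry P.Ω} {u' : L2Bdry P.Ω} {C : ℝ} (h : ∀ n, P.Feasible (w n) (z n) (u n))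
    (hw'c : ContinuousOn w' (Icc 0 P.T)) (hz'c : ContinuousOn z' (Icc 0 P.T))
    (hw : ∀ t ∈ Icc 0 P.T, Tendsto (fun n => w n t) atTop (𝓝 (w' t)))
    (hz : ∀ t ∈ Icc 0 P.T, Tendsto (fun n => z n t) atTop (𝓝 (z' t)))
    (hC : ∀ n, ‖u n‖ ≤ C)
    (hu : Tendsto (fun n => toWeakSpace ℝ (L2Bdry P.Ω) (u n)) atTop
      (𝓝 (toWeakSpace ℝ (L2Bdry P.Ω) u'))) :
    P.Feasible w' z' u' := by
  choose hw₀ hz₀ hc hwv hzv using fun n => hP.feasible_iff.1 (h n)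
  obtain ⟨Λ, hΛ⟩ := hP.exists_potential_eq
  obtain ⟨K, hK⟩ := hP.exists_norm_acceleration_potential_le C
  have h0 : (0 : ℝ) ∈ Icc 0 P.T := ⟨le_rfl, hP.T_pos.le⟩
  have hv : Continuous P.v := continuous_v hP.m₀_pos.ne'
  have hη : Tendsto (fun n => toWeakSpace ℝ (L2 P.Ω) (potential P.Ω (u n))) atTop
      (𝓝 (toWeakSpace ℝ (L2 P.Ω) (potential P.Ω u'))) := by
    rw [hΛ]
    exact ((WeakSpace.map Λ).continuous.tendsto _).comp hu
  have hηC : ∀ n, ‖potential P.Ω (u n)‖ ≤ ‖Λ‖ * C := fun n => by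
    rw [hΛ]
    exact Λ.le_opNorm_of_le (hC n)
  refine hP.feasible_iff.2 ⟨tendsto_nhds_unique (hw 0 h0) (by simp only [hw₀, tendsto_const_nhds]),
    tendsto_nhds_unique (hz 0 h0) (by simp only [hz₀, tendsto_const_nhds]),
    fun i t ht => ?_, ?_, ?_⟩
  · exact le_of_tendsto' (((hP.g_continuous i).tendsto _).comp ((hw t ht).add_const _))
      fun n => hc n i t ht
  · exact .of_tendsto hP.T_pos hwv (fun _ _ _ => norm_v_le hP.m₀_pos hP.c_pos _) (by fun_prop) hw
      fun t ht => (hv.tendsto _).comp ((hz t ht).add_const _)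
  · exact .of_tendsto hP.T_pos hzv (fun n => hK _ _ _ (hC n))
      (hP.continuousOn_acceleration hw'c hz'c _) hz fun t ht => hP.tendsto_acceleration
        (fun n => (hwv n).continuousOn) (fun n => (hzv n).continuousOn) hw hz hη hηC ht

theorem exists_subseq_tendsto_feasible (hP : P.ExistenceAssumptions) {w z : ℕ → ℝ → E3}
    {u : ℕ → L2Bdry P.Ω} {C : ℝ} (h : ∀ n, P.Feasible (w n) (z n) (u n)) (hC : ∀ n, ‖u n‖ ≤ C) :
    ∃ (w' z' : ℝ → E3) (u' : L2Bdry P.Ω) (k : ℕ → ℕ), P.Feasible w' z' u' ∧ StrictMono k ∧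
      (∀ t ∈ Icc 0 P.T, Tendsto (fun n => w (k n) t) atTop (𝓝 (w' t))) ∧
      Tendsto (fun n => toWeakSpace ℝ (L2Bdry P.Ω) (u (k n))) atTop
        (𝓝 (toWeakSpace ℝ (L2Bdry P.Ω) u')) := by
  choose hw₀ hz₀ _ hwv hzv using fun n => hP.feasible_iff.1 (h n)
  obtain ⟨K, hK⟩ := hP.exists_norm_acceleration_potential_le C
  have hwL (n : ℕ) : LipschitzOnWith P.c.toNNReal (w n) (Icc 0 P.T) :=
    (hwv n).lipschitzOnWith fun t _ => (norm_v_le hP.m₀_pos hP.c_pos _).trans P.c.le_coe_toNNReal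
  have hzL (n : ℕ) : LipschitzOnWith K.toNNReal (z n) (Icc 0 P.T) :=
    (hzv n).lipschitzOnWith fun t ht => (hK _ _ _ (hC n) t ht).trans K.le_coe_toNNReal
  have := hP.isFiniteMeasure_surface
  have : Fact ((2 : ENNReal) ≠ ⊤) := ⟨ENNReal.ofNat_ne_top⟩
  obtain ⟨u', k₁, hk₁, hu'⟩ := exists_subseq_tendsto_toWeakSpace hC
  obtain ⟨y, k₂, hy, hk₂, hlim⟩ := exists_subseq_tendsto_of_lipschitzOn hP.T_pos.le
    (f := fun n t => (w (k₁ n) t, z (k₁ n) t)) (x₀ := (0, 0))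
    (fun n => (hwL (k₁ n)).prodMk (hzL (k₁ n)))
    (fun n => Prod.ext (hw₀ (k₁ n)) (hz₀ (k₁ n)))
  have hw := fun t ht => (hlim t ht).fst_nhds
  have hz := fun t ht => (hlim t ht).snd_nhds
  have hu := hu'.comp hk₂.tendsto_atTop
  exact ⟨fun t => (y t).1, fun t => (y t).2, u', k₁ ∘ k₂,
    hP.feasible_of_tendsto (fun n => h (k₁ (k₂ n))) (by fun_prop) (by fun_prop) hw hz
      (fun n => hC _) hu, hk₁.comp hk₂, hw, hu⟩

theorem exists_coercive_bound (hP : P.ExistenceAssumptions) :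
    ∃ b : ℝ, ∀ w z u, P.Feasible w z u →
      b + P.α / 2 * ‖u‖ ^ 2 ≤ P.objective (fun t => w t + P.r₀) u := by
  obtain ⟨c₁, hc₁⟩ := hP.J₁_bddBelow
  obtain ⟨c₂, hc₂⟩ := hP.J₂_bddBelow
  refine ⟨(∫ _ in (0 : ℝ)..P.T, c₁) + c₂, fun w z u h => ?_⟩
  have hw : ContinuousOn w (Icc 0 P.T) := h.1.1.1.continuousOn
  have hJ₁w : IntervalIntegrable (fun t => P.J₁ (w t + P.r₀)) volume 0 P.T :=
    (hP.J₁_continuous.comp_continuousOn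
      (hw.add continuousOn_const)).intervalIntegrable_of_Icc hP.T_pos.le
  have hint : ∫ _ in (0 : ℝ)..P.T, c₁ ≤ ∫ t in (0 : ℝ)..P.T, P.J₁ (w t + P.r₀) :=
    intervalIntegral.integral_mono_on hP.T_pos.le intervalIntegrable_const hJ₁w fun t _ => hc₁ _
  rw [objective_eq]
  gcongr
  exact hc₂ _

theorem exists_norm_le_of_objective_le (hP : P.ExistenceAssumptions) (M : ℝ) :
    ∃ C, ∀ w z u, P.Feasible w z u → P.objective (fun t => w t + P.r₀) u ≤ M → ‖u‖ ≤ C := by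
  obtain ⟨b, hb⟩ := hP.exists_coercive_bound
  refine ⟨√((M - b) * 2 / P.α), fun w z u h hM => Real.le_sqrt_of_sq_le ?_⟩
  rw [le_div_iff₀ hP.α_pos]
  linarith [hb w z u h]

theorem tendsto_integral_J₁ (hP : P.ExistenceAssumptions) {w : ℕ → ℝ → E3} {w' : ℝ → E3}
    (hwc : ∀ n, ContinuousOn (w n) (Icc 0 P.T)) (hc : ∀ n, P.StateConstraint (w n))
    (hw : ∀ t ∈ Icc 0 P.T, Tendsto (fun n => w n t) atTop (𝓝 (w' t))) :
    Tendsto (fun n => ∫ t in (0 : ℝ)..P.T, P.J₁ (w n t + P.r₀)) atTop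
      (𝓝 (∫ t in (0 : ℝ)..P.T, P.J₁ (w' t + P.r₀))) := by
  have hbdd : Bornology.IsBounded P.admissible := hP.isBounded.subset hP.admissible_subset
  obtain ⟨B, hB⟩ := hbdd.isCompact_closure.exists_bound_of_continuousOn
    hP.J₁_continuous.continuousOn
  have hsub : uIoc 0 P.T ⊆ Icc 0 P.T := by
    rw [uIoc_of_le hP.T_pos.le]
    exact Ioc_subset_Icc_self
  refine intervalIntegral.tendsto_integral_filter_of_dominated_convergence (fun _ => B)
    (Eventually.of_forall fun n => ?_) (Eventually.of_forall fun n => ae_of_all _ fun t ht =>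
      hB _ (subset_closure ((hc n).mem_admissible (hsub ht)))) intervalIntegrable_const
    (ae_of_all _ fun t ht => (hP.J₁_continuous.tendsto _).comp ((hw t (hsub ht)).add_const _))
  exact (hP.J₁_continuous.comp_continuousOn
    (((hwc n).mono hsub).add continuousOn_const)).aestronglyMeasurable measurableSet_uIoc

theorem objective_le_of_tendsto (hP : P.ExistenceAssumptions) {w z : ℕ → ℝ → E3} {w' : ℝ → E3}
    {u : ℕ → L2Bdry P.Ω} {u' : L2Bdry P.Ω} {I : ℝ} (h : ∀ n, P.Feasible (w n) (z n) (u n))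
    (hw : ∀ t ∈ Icc 0 P.T, Tendsto (fun n => w n t) atTop (𝓝 (w' t)))
    (hu : Tendsto (fun n => toWeakSpace ℝ (L2Bdry P.Ω) (u n)) atTop
      (𝓝 (toWeakSpace ℝ (L2Bdry P.Ω) u')))
    (hI : Tendsto (fun n => P.objective (fun t => w n t + P.r₀) (u n)) atTop (𝓝 I)) :
    P.objective (fun t => w' t + P.r₀) u' ≤ I := by
  have hα := hP.α_pos
  have hJ₁ := hP.tendsto_integral_J₁ (fun n => (h n).1.1.1.continuousOn) (fun n => (h n).2) hw
  have hJ₂ : Tendsto (fun n => P.J₂ (w n P.T + P.r₀)) atTop (𝓝 (P.J₂ (w' P.T + P.r₀))) :=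
    (hP.J₂_continuous.tendsto _).comp ((hw P.T ⟨hP.T_pos.le, le_rfl⟩).add_const _)
  -- The square of the norm lies above its tangent at `u'`, which is weakly continuous.
  have htangent (n : ℕ) : 2 * inner ℝ u' (u n) - ‖u'‖ ^ 2 ≤ ‖u n‖ ^ 2 := by
    linarith [norm_sub_sq_real u' (u n), sq_nonneg ‖u' - u n‖]
  have hinner : Tendsto (fun n => inner ℝ u' (u n)) atTop (𝓝 (‖u'‖ ^ 2)) := by
    rw [← real_inner_self_eq_norm_sq]
    exact tendsto_apply_of_tendsto_toWeakSpace hu (innerSL ℝ u')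
  have hlim := (hJ₁.add hJ₂).add (((hinner.const_mul 2).sub_const (‖u'‖ ^ 2)).const_mul (P.α / 2))
  have hle := le_of_tendsto_of_tendsto' hlim hI fun n => by
    rw [objective_eq]
    gcongr
    exact htangent n
  rw [objective_eq]
  linarith

end ExistenceAssumptions

end ProblemData

end AbrahamControl

end

theorem mainTheorem2_general (P : AbrahamControl.ProblemData) (hP : P.ExistenceAssumptions)
    (hfeas : ∃ (u : AbrahamControl.L2Bdry P.Ω) (w z : ℝ → AbrahamControl.E3),
      P.IsState w z u ∧ P.StateConstraint w) :
    ∃ u : AbrahamControl.L2Bdry P.Ω, P.IsOptimalControl u := by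
  obtain ⟨u₀, w₀, z₀, h₀⟩ := hfeas
  obtain ⟨b, hb⟩ := hP.exists_coercive_bound
  have hα := hP.α_pos
  obtain ⟨⟨w, z, u⟩, hy, hmin⟩ := AbrahamControl.exists_isMinOn_of_forall_seq
    (S := {y : (ℝ → AbrahamControl.E3) × (ℝ → AbrahamControl.E3) × AbrahamControl.L2Bdry P.Ω |
      P.Feasible y.1 y.2.1 y.2.2})
    (f := fun y => P.objective (fun t => y.1 t + P.r₀) y.2.2) ⟨(w₀, z₀, u₀), h₀⟩
    ⟨b, by
      rintro _ ⟨y, hy, rfl⟩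
      exact (le_add_of_nonneg_right (by positivity)).trans (hb _ _ _ hy)⟩
    fun x hx I hI => by
      obtain ⟨M, hM⟩ := hI.bddAbove_range
      obtain ⟨C, hC⟩ := hP.exists_norm_le_of_objective_le M
      obtain ⟨w, z, u, k, h, hk, hw, hu⟩ := hP.exists_subseq_tendsto_feasible hx
        fun n => hC _ _ _ (hx n) (hM ⟨n, rfl⟩)
      exact ⟨(w, z, u), h, hP.objective_le_of_tendsto (fun n => hx (k n)) hw hu
        (hI.comp hk.tendsto_atTop)⟩
  exact ⟨u, w, z, hy, fun w' z' u' h => hmin (a := (w', z', u')) h⟩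

theorem mainTheorem2 (P : AbrahamControl.ProblemData) (hP : P.StandingAssumptions)
    (hfeas : ∃ (u : AbrahamControl.L2Bdry P.Ω) (w z : ℝ → AbrahamControl.E3),
      P.IsState w z u ∧ P.StateConstraint w) :
    ∃ u : AbrahamControl.L2Bdry P.Ω, P.IsOptimalControl u :=
  mainTheorem2_general P hP.existenceAssumptions hfeas
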